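/- Notation. For $\tau$ in the upper half-plane and $q=e^{2\pi i\tau}$ put $g_2(\tau)=\frac{(2\pi)^4}{12}\bigl(1+240\sum_{n\ge1}\sigma_3(n)q^n\bigr)$, $g_3(\tau)=\frac{(2\pi)^6}{216}\bigl(1-504\sum_{n\ge1}\sigma_5(n)q^n\bigr)$ with $\sigma_k(n)=\sum_{d\mid n}d^k$, $\Delta=g_2^3-27g_3^2$ and $j(\tau)=1728\,g_2(\tau)^3/\Delta(\tau)$. Write $\sqrt{-n}=i\sqrt n$ for $n>0$. For a prime $\ell\equiv 3 \pmod 4$ and $D\in\{\ell,4\ell\}$ let $P_D$ be the monic polynomial whose roots, each with multiplicity one, are exactly the finitely many $j$-invariants of the elliptic curves over $\mathbb{C}$ with complex multiplication by (that is, with endomorphism ring isomorphic to) the order $\mathbb{Z}\bigl[\frac{D+\sqrt{-D}}{2}\bigr]$. Lemma. Let $E$ be an elliptic curve over $\mathbb{Q}$ with $j$-invariant $j_E$, and let $$B_E=\begin{cases}\left(\frac{\log j_E}{2\pi}\right)^2 & \text{if } j_E>0,\\[2pt] \left(\frac{\log|j_E|}{\pi}+1\right)^2 & \text{if } j_E<0,\\[2pt]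 0 & \text{if } j_E=0.\end{cases}$$ Then for every prime $\ell\equiv 3\pmod 4$ with $\ell>\max\{B_E,7\}$, the values $j\bigl(\frac{1+\sqrt{-\ell}}{2}\bigr)$ and $j(\sqrt{-\ell})$ are real and $$j\Bigl(\frac{1+\sqrt{-\ell}}{2}\Bigr)<j_E<j(\sqrt{-\ell}),$$ and hence $P_\ell(j_E)$ and $P_{4\ell}(j_E)$ are real with $P_\ell(j_E)>0$ and $P_{4\ell}(j_E)<0$. -/

import Mathlib

-- With this order on the complex numbers, `z < w` means `z.re < w.re` and `z.im = w.im`; so an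
-- inequality between a complex number and a real one includes that the former is real.
open scoped ComplexOrder

noncomputable section

namespace SingularModuli

open Complex Polynomial Filter Topology
open UpperHalfPlane hiding I

/-! ### The modular `j`-function -/

/-- `g₂(τ) = (2π)⁴ / 12 · (1 + 240 ∑ σ₃(n) qⁿ)` with `q = exp(2πiτ)`. -/
def modularG₂ (τ : ℍ) : ℂ :=
  (2 * Real.pi) ^ 4 * (1 / (2 ^ 2 * 3)) *
    (1 + 240 * ∑' n : ℕ+, (ArithmeticFunction.sigma 3 n : ℂ) * cexp (2 * Real.pi * I * τ) ^ (n : ℕ))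

/-- `g₃(τ) = (2π)⁶ / 216 · (1 - 504 ∑ σ₅(n) qⁿ)` with `q = exp(2πiτ)`. -/
def modularG₃ (τ : ℍ) : ℂ :=
  (2 * Real.pi) ^ 6 * (1 / (2 ^ 3 * 3 ^ 3)) *
    (1 - 504 * ∑' n : ℕ+, (ArithmeticFunction.sigma 5 n : ℂ) * cexp (2 * Real.pi * I * τ) ^ (n : ℕ))

/-- `Δ(τ) = g₂(τ)³ - 27 g₃(τ)²`. -/
def modularDelta (τ : ℍ) : ℂ := modularG₂ τ ^ 3 - 27 * modularG₃ τ ^ 2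

/-- The modular `j`-function `j(τ) = 1728 g₂(τ)³ / Δ(τ)`. -/
def modularJ (τ : ℍ) : ℂ := 1728 * (modularG₂ τ ^ 3 / modularDelta τ)

/-- The point `√-n = i √n` of the upper half-plane. -/
def sqrtNeg (n : ℕ) (hn : 0 < n) : ℍ :=
  ⟨I * (Real.sqrt n : ℂ), by simpa using hn⟩

/-- The point `(1 + √-n) / 2` of the upper half-plane. -/
def halfOneAddSqrtNeg (n : ℕ) (hn : 0 < n) : ℍ :=
  ⟨(1 + I * (Real.sqrt n : ℂ)) / 2, by
    have h : (1 + I * (Real.sqrt n : ℂ)) / 2 = ((1 / 2 : ℝ) : ℂ) + ((Real.sqrt n / 2 : ℝ) : ℂ) * I := by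
      push_cast; ring
    rw [h]
    simpa using hn⟩

/-! ### Complex elliptic curves with complex multiplication -/

/-- The group endomorphism `φ` of the complex torus `ℂ / Λ` is holomorphic: locally it lifts to a
holomorphic function along the covering `ℂ → ℂ / Λ` (whose local inverses are the charts of the
torus). -/
def IsHolomorphicEnd (L : PeriodPair) (φ : AddMonoid.End (ℂ ⧸ L.lattice)) : Prop :=
  ∀ z : ℂ, ∃ f : ℂ → ℂ, AnalyticAt ℂ f z ∧
    ∀ᶠ w in 𝓝 z, φ (L.lattice.mkQ w) = L.lattice.mkQ (f w)

/-- The endomorphism ring of the complex torus `ℂ / Λ`: the ring of its holomorphic group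
endomorphisms. -/
def torusEnd (L : PeriodPair) : Subring (AddMonoid.End (ℂ ⧸ L.lattice)) where
  carrier := {φ | IsHolomorphicEnd L φ}
  zero_mem' z := ⟨fun _ ↦ 0, analyticAt_const, by simp⟩
  one_mem' z := ⟨id, analyticAt_id, by simp⟩
  add_mem' {φ ψ} hφ hψ z := by
    obtain ⟨f, hf, hf'⟩ := hφ z
    obtain ⟨g, hg, hg'⟩ := hψ z
    refine ⟨fun w ↦ f w + g w, hf.add hg, ?_⟩
    filter_upwards [hf', hg'] with w h₁ h₂
    rw [map_add, ← h₁, ← h₂]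
    rfl
  neg_mem' {φ} hφ z := by
    obtain ⟨f, hf, hf'⟩ := hφ z
    refine ⟨fun w ↦ -f w, hf.neg, ?_⟩
    filter_upwards [hf'] with w h₁
    rw [map_neg, ← h₁]
    rfl
  mul_mem' {φ ψ} hφ hψ z := by
    obtain ⟨g, hg, hg'⟩ := hψ z
    obtain ⟨f, hf, hf'⟩ := hφ (g z)
    refine ⟨fun w ↦ f (g w), hf.comp hg, ?_⟩
    filter_upwards [hg', hg.continuousAt.eventually hf'] with w h₁ h₂
    rw [← h₂, ← h₁]
    rfl

/-- The elliptic curve attached to a lattice `Λ` in `ℂ`. The equation `Y² = 4X³ - g₂(Λ)X - g₃(Λ)`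
satisfied by `(℘, ℘')` becomes `y² = x³ - (g₂(Λ)/4)x - g₃(Λ)/4` for `(x, y) = (℘, ℘'/2)`. -/
def latticeCurve (L : PeriodPair) : WeierstrassCurve ℂ :=
  ⟨0, 0, 0, -L.g₂ / 4, -L.g₃ / 4⟩

/-- The complex elliptic curve `W` has complex multiplication by the order `O`: its endomorphism
ring is isomorphic to `O`. The endomorphism ring of `W` is that of the complex torus `ℂ / Λ` which
uniformizes `W`. -/
def HasCMBy (W : WeierstrassCurve ℂ) (O : Subalgebra ℤ ℂ) : Prop :=
  ∃ L : PeriodPair, (∃ C : WeierstrassCurve.VariableChange ℂ, C • W = latticeCurve L) ∧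
    Nonempty (O ≃+* torusEnd L)

/-- The ring `ℤ[(D + √-D) / 2]`. -/
def quadraticOrder (D : ℕ) : Subalgebra ℤ ℂ :=
  Algebra.adjoin ℤ {((D : ℂ) + I * (Real.sqrt D : ℂ)) / 2}

/-- The `j`-invariants of the complex elliptic curves with complex multiplication by
`ℤ[(D + √-D) / 2]`. -/
def cmJInvariants (D : ℕ) : Set ℂ :=
  {j | ∃ (W : WeierstrassCurve ℂ) (_ : W.IsElliptic), HasCMBy W (quadraticOrder D) ∧ W.j = j}

/-- The monic polynomial `P_D` whose roots are, each with multiplicity one, the (finitely many)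
`j`-invariants of the elliptic curves with complex multiplication by `ℤ[(D + √-D) / 2]`. -/
def cmPolynomial (D : ℕ) : ℂ[X] :=
  ∏ᶠ j ∈ cmJInvariants D, (X - C j)

/-- The bound `B_E` as a function of the `j`-invariant of `E`. -/
def jBound (j : ℝ) : ℝ :=
  if 0 < j then (Real.log j / (2 * Real.pi)) ^ 2
  else if j < 0 then (Real.log |j| / Real.pi + 1) ^ 2
  else 0

end SingularModuli

end

/-!
The two inequalities come from `q`-expansions. Since `1728 Δ = E₄³ - E₆²` and `Δ = q ∏ (1 - qⁿ)²⁴`,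
the function `j` equals `E₄³ / (q ∏ (1 - qⁿ)²⁴)`. At `√-ℓ` the parameter `q = exp (-2π√ℓ)` is
positive and `j ≥ q⁻¹` (`exists_modularJ_eq_ofReal_ge`). At `(1 + √-ℓ) / 2` the parameter
`q = -exp (-π√ℓ)` is negative and very small, and `j ≤ q⁻¹ / 20`
(`exists_modularJ_eq_ofReal_le`); as `exp π > 20`, both bounds go beyond `j_E`.

The sign of `P_D(j_E)` then follows once the roots of `P_D` are known to be finite in number and
stable under complex conjugation, with exactly one real root, namely `j((1 + √-ℓ) / 2)` for
`D = ℓ` and `j(√-ℓ)` for `D = 4ℓ`: the other roots come in conjugate pairs and contribute a positive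
factor (`exists_prod_sub_eq_of_conj_stable`).

A holomorphic endomorphism of `ℂ / Λ` is multiplication by some `α` with `α Λ ⊆ Λ`
(`multiplierRingEquiv`), so the roots of `P_D` are the `j`-invariants of the lattices whose ring of
multipliers is the order `O = ℤ[ω]`, `ω = (D + √-D) / 2` (`mem_cmJInvariants_iff`). After scaling by
a shortest vector such a lattice is `ℤ τ + ℤ` with `ω = a τ + n` and `a ≤ D`, whence finiteness
(`finite_cmJInvariants`).

If the `j`-invariant of `Λ` is real, then `Λ` and its conjugate have the same `j`-invariant, hence
are homothetic. This uses the injectivity of `j` on homothety classes, which is deduced from the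
differential equation of `℘`: if two lattices have the same `g₂` and `g₃`, the difference of their
`℘`-functions is holomorphic at `0`, and the difference of the two equations
`℘'² = 4℘³ - g₂℘ - g₃` forces it to vanish (`weierstrassPExcept_eventuallyEq`). So `Λ` may be taken
stable under conjugation and of the form `ℤ τ + ℤ` with `2 Re τ = p` an integer. As `Λ` is a module
over `O`, `4 a c = a² p² + D` for an integer `c`; as no larger ring acts on `Λ`, `a` and `c` are not
both even. Since `ℓ` is a prime congruent to `3` modulo `4`, this leaves `a = 1` and `a = ℓ`, for
both of which `Λ` is homothetic to `O` (`eq_modularJ_orderPoint_of_real`).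
-/

noncomputable section

namespace SingularModuli

open Complex Filter Topology ComplexConjugate PeriodPair
open UpperHalfPlane hiding I

/-! ### The lattice is determined by `g₂` and `g₃` -/

lemma eventually_notMem_lattice (L : PeriodPair) (x : ℂ) : ∀ᶠ z in 𝓝[≠] x, z ∉ L.lattice := by
  filter_upwards [self_mem_nhdsWithin,
    mem_nhdsWithin_of_mem_nhds (L.compl_lattice_sdiff_singleton_mem_nhds x)] with w hw hw' hL
  exact hw' ⟨hL, hw⟩

lemma weierstrassP_eq_except_zero_add (L : PeriodPair) (z : ℂ) :
    ℘[L] z = ℘[L - (0 : ℂ)] z + 1 / z ^ 2 := by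
  have := L.weierstrassPExcept_add 0 z
  simp at this
  simp [← this]

lemma derivWeierstrassP_eq_except_zero_sub (L : PeriodPair) (z : ℂ) :
    ℘'[L] z = ℘'[L - (0 : ℂ)] z - 2 / z ^ 3 := by
  have := L.derivWeierstrassPExcept_def 0 z
  simp at this
  simp [this]

lemma deriv_weierstrassPExcept_zero (L : PeriodPair) :
    ∀ᶠ z in 𝓝 0, deriv ℘[L - (0 : ℂ)] z = ℘'[L - (0 : ℂ)] z := by
  filter_upwards [L.compl_lattice_sdiff_singleton_mem_nhds 0] with z hz
  exact L.eqOn_deriv_weierstrassPExcept_derivWeierstrassPExcept 0 hz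

/-- The difference of the equations `℘'² = 4℘³ - g₂℘ - g₃` of two lattices with the same `g₂`, `g₃`
is linear in the difference of the `℘`-functions. -/
lemma weierstrassP_sub_ode {L₁ L₂ : PeriodPair} (h₂ : L₁.g₂ = L₂.g₂)
    (h₃ : L₁.g₃ = L₂.g₃) {z : ℂ} (hz₁ : z ∉ L₁.lattice) (hz₂ : z ∉ L₂.lattice) :
    (℘'[L₁] z - ℘'[L₂] z) * (℘'[L₁] z + ℘'[L₂] z) = (℘[L₁] z - ℘[L₂] z) *
      (4 * (℘[L₁] z ^ 2 + ℘[L₁] z * ℘[L₂] z + ℘[L₂] z ^ 2) - L₁.g₂) := by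
  have e₁ := L₁.derivWeierstrassP_sq z hz₁
  have e₂ := L₂.derivWeierstrassP_sq z hz₂
  rw [← h₂, ← h₃] at e₂
  linear_combination e₁ - e₂

/-- If `D = ℘₁ - ℘₂` had a zero of order `n` at `0`, with leading coefficient `g(0)`, the leading
coefficients in `D' (℘₁' + ℘₂') = D (4 (℘₁² + ℘₁ ℘₂ + ℘₂²) - g₂)` would give
`-4 n g(0) = 12 g(0)`. -/
lemma weierstrassPExcept_eventuallyEq {L₁ L₂ : PeriodPair} (h₂ : L₁.g₂ = L₂.g₂)
    (h₃ : L₁.g₃ = L₂.g₃) :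
    ∀ᶠ z in 𝓝 0, ℘[L₁ - (0 : ℂ)] z = ℘[L₂ - (0 : ℂ)] z := by
  have ha₁ := L₁.analyticAt_weierstrassPExcept 0
  have ha₂ := L₂.analyticAt_weierstrassPExcept 0
  have hb₁ := L₁.analyticAt_derivWeierstrassPExcept 0
  have hb₂ := L₂.analyticAt_derivWeierstrassPExcept 0
  have hd := ha₁.sub ha₂
  by_contra hne
  have hord : analyticOrderAt (℘[L₁ - (0 : ℂ)] - ℘[L₂ - (0 : ℂ)]) 0 ≠ ⊤ := by
    rw [Ne, analyticOrderAt_eq_top]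
    intro h
    exact hne (h.mono fun z hz ↦ sub_eq_zero.mp hz)
  obtain ⟨g, hg, hg0, hge⟩ := hd.analyticOrderAt_ne_top.mp hord
  set n := analyticOrderNatAt (℘[L₁ - (0 : ℂ)] - ℘[L₂ - (0 : ℂ)]) 0
  simp only [sub_zero, smul_eq_mul] at hge
  -- both sides of the differential equation, multiplied by `z ^ 4` and divided by `z ^ n`
  let A : ℂ → ℂ := fun z ↦ (n * g z + z * deriv g z) *
    (z ^ 3 * (℘'[L₁ - (0 : ℂ)] z + ℘'[L₂ - (0 : ℂ)] z) - 4)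
  let B : ℂ → ℂ := fun z ↦ g z *
    (4 * ((z ^ 2 * ℘[L₁ - (0 : ℂ)] z + 1) ^ 2 +
      (z ^ 2 * ℘[L₁ - (0 : ℂ)] z + 1) * (z ^ 2 * ℘[L₂ - (0 : ℂ)] z + 1) +
      (z ^ 2 * ℘[L₂ - (0 : ℂ)] z + 1) ^ 2) - L₁.g₂ * z ^ 4)
  have hA : ContinuousAt A 0 := by
    have := hg.continuousAt
    have := hg.deriv.continuousAt
    have := hb₁.continuousAt
    have := hb₂.continuousAt
    fun_prop
  have hB : ContinuousAt B 0 := by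
    have := hg.continuousAt
    have := ha₁.continuousAt
    have := ha₂.continuousAt
    fun_prop
  have hAB : ∀ᶠ z in 𝓝[≠] 0, A z = B z := by
    have hder : ∀ᶠ z in 𝓝 0, ℘'[L₁ - (0 : ℂ)] z - ℘'[L₂ - (0 : ℂ)] z =
        n * z ^ (n - 1) * g z + z ^ n * deriv g z := by
      filter_upwards [hge.eventually_nhds, hg.eventually_analyticAt, ha₁.eventually_analyticAt,
        ha₂.eventually_analyticAt, deriv_weierstrassPExcept_zero L₁,
        deriv_weierstrassPExcept_zero L₂] with z h₁ h₂ h₃ h₄ h₅ h₆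
      rw [← h₅, ← h₆, ← deriv_sub h₃.differentiableAt h₄.differentiableAt,
        Filter.EventuallyEq.deriv_eq h₁, deriv_fun_mul (by fun_prop) h₂.differentiableAt]
      simp
    filter_upwards [self_mem_nhdsWithin, eventually_notMem_lattice L₁ 0,
      eventually_notMem_lattice L₂ 0, hder.filter_mono nhdsWithin_le_nhds,
      hge.filter_mono nhdsWithin_le_nhds] with z hz hz₁ hz₂ hz₃ hz₄
    replace hz : z ≠ 0 := hz
    have := weierstrassP_sub_ode h₂ h₃ hz₁ hz₂
    simp only [weierstrassP_eq_except_zero_add, derivWeierstrassP_eq_except_zero_sub] at this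
    have hn : (n : ℂ) * z ^ (n - 1) * z = n * z ^ n := by
      rcases n with _ | n
      · simp
      · simp [pow_succ, mul_assoc]
    simp only [Pi.sub_apply] at hz₄
    have e₁ : ℘'[L₁ - (0 : ℂ)] z - 2 / z ^ 3 - (℘'[L₂ - (0 : ℂ)] z - 2 / z ^ 3) =
        n * z ^ (n - 1) * g z + z ^ n * deriv g z := by rw [← hz₃]; ring
    have e₂ : ℘[L₁ - (0 : ℂ)] z + 1 / z ^ 2 - (℘[L₂ - (0 : ℂ)] z + 1 / z ^ 2) =
        z ^ n * g z := by rw [← hz₄]; ring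
    rw [e₁, e₂] at this
    refine mul_left_cancel₀ (pow_ne_zero n hz) ?_
    have key : z ^ n * A z = (n * z ^ (n - 1) * z * g z + z ^ n * z * deriv g z) *
      (z ^ 3 * (℘'[L₁ - (0 : ℂ)] z + ℘'[L₂ - (0 : ℂ)] z) - 4) := by
      rw [hn]; simp only [A]; ring
    rw [key]
    have hb : z ^ 3 * (℘'[L₁ - (0 : ℂ)] z + ℘'[L₂ - (0 : ℂ)] z) - 4 =
        z ^ 3 * (℘'[L₁ - (0 : ℂ)] z - 2 / z ^ 3 + (℘'[L₂ - (0 : ℂ)] z - 2 / z ^ 3)) := by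
      field_simp
      ring
    have ha (L : PeriodPair) : z ^ 2 * ℘[L - (0 : ℂ)] z + 1 =
        z ^ 2 * (℘[L - (0 : ℂ)] z + 1 / z ^ 2) := by
      field_simp
    simp only [B, hb, ha]
    linear_combination z ^ 4 * this
  have hlim := tendsto_nhds_unique_of_eventuallyEq (hA.mono_left nhdsWithin_le_nhds)
    (hB.mono_left nhdsWithin_le_nhds) hAB
  simp only [A, B] at hlim
  norm_num at hlim
  have h16 : (n : ℂ) + 3 = 0 := mul_left_cancel₀ hg0 (by linear_combination -hlim / 4)
  have : ((n + 3 : ℕ) : ℂ) = 0 := by exact_mod_cast h16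
  exact absurd this (Nat.cast_ne_zero.mpr (by omega))

lemma weierstrassP_eqOn {L₁ L₂ : PeriodPair} (h₂ : L₁.g₂ = L₂.g₂) (h₃ : L₁.g₃ = L₂.g₃) :
    Set.EqOn ℘[L₁] ℘[L₂] ((L₁.lattice : Set ℂ) ∪ L₂.lattice)ᶜ := by
  have hcount (L : PeriodPair) : (L.lattice : Set ℂ).Countable :=
    (L.latticeEquivProd.toEquiv.countable_iff.mpr inferInstance : Countable L.lattice)
  -- the complement of a countable set in the plane is connected
  have hconn : IsPreconnected ((L₁.lattice : Set ℂ) ∪ L₂.lattice)ᶜ :=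
    (((hcount L₁).union (hcount L₂)).isPathConnected_compl_of_one_lt_rank
      (by simp [Complex.rank_real_complex])).isConnected.isPreconnected
  have ev : ∀ᶠ z in 𝓝[≠] (0 : ℂ), ℘[L₁] z = ℘[L₂] z := by
    filter_upwards [(weierstrassPExcept_eventuallyEq h₂ h₃).filter_mono nhdsWithin_le_nhds]
      with z hz
    simp [weierstrassP_eq_except_zero_add, hz]
  obtain ⟨z₀, hz₀, hz₁, hz₂⟩ := ((eventually_eventually_nhdsWithin.mpr ev).and
    ((eventually_notMem_lattice L₁ 0).and (eventually_notMem_lattice L₂ 0))).exists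
  have hne : z₀ ≠ 0 := fun h ↦ hz₁ (h ▸ zero_mem _)
  rw [isOpen_compl_singleton.nhdsWithin_eq hne] at hz₀
  exact (L₁.analyticOnNhd_weierstrassP.mono
      (Set.compl_subset_compl.mpr Set.subset_union_left)).eqOn_of_preconnected_of_eventuallyEq
    (L₂.analyticOnNhd_weierstrassP.mono (Set.compl_subset_compl.mpr Set.subset_union_right))
    hconn (by simp [hz₁, hz₂]) hz₀

/-- The invariants `g₂` and `g₃` determine the lattice. -/
theorem lattice_eq_of_g₂_eq_of_g₃_eq {L₁ L₂ : PeriodPair} (h₂ : L₁.g₂ = L₂.g₂)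
    (h₃ : L₁.g₃ = L₂.g₃) : L₁.lattice = L₂.lattice := by
  suffices H : ∀ {L₁ L₂ : PeriodPair}, L₁.g₂ = L₂.g₂ → L₁.g₃ = L₂.g₃ → L₁.lattice ≤ L₂.lattice from
    le_antisymm (H h₂ h₃) (H h₂.symm h₃.symm)
  intro L₁ L₂ h₂ h₃ l hl
  by_contra hl'
  have ev : ℘[L₁] =ᶠ[𝓝[≠] l] ℘[L₂] := by
    filter_upwards [eventually_notMem_lattice L₁ l, eventually_notMem_lattice L₂ l] with z hz₁ hz₂
    exact weierstrassP_eqOn h₂ h₃ (by simp [hz₁, hz₂])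
  -- `℘[L₁]` has a double pole at `l`, where `℘[L₂]` is analytic
  have h := L₁.order_weierstrassP l hl
  rw [meromorphicOrderAt_congr ev] at h
  have := (L₂.analyticOnNhd_weierstrassP l hl').meromorphicOrderAt_nonneg
  rw [h] at this
  exact absurd this (by decide)

/-! ### Lattices, their `j`-invariants and the modular function `j` -/

/-- The image of a pair of periods under an `ℝ`-linear automorphism of `ℂ`. -/
def mapPeriods (L : PeriodPair) (e : ℂ ≃ₗ[ℝ] ℂ) : PeriodPair where
  ω₁ := e L.ω₁
  ω₂ := e L.ω₂
  indep := by
    have := L.indep.map' e.toLinearMap e.ker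
    rwa [show e.toLinearMap ∘ ![L.ω₁, L.ω₂] = ![e L.ω₁, e L.ω₂] by
      ext i; fin_cases i <;> rfl] at this

lemma apply_mem_mapPeriods_iff (L : PeriodPair) (e : ℂ ≃ₗ[ℝ] ℂ) (x : ℂ) :
    e x ∈ (mapPeriods L e).lattice ↔ x ∈ L.lattice := by
  simp only [PeriodPair.mem_lattice, mapPeriods, ← zsmul_eq_mul, ← map_zsmul, ← map_add,
    e.injective.eq_iff]

lemma G_mapPeriods (L : PeriodPair) (e : ℂ ≃ₗ[ℝ] ℂ) (n : ℕ) :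
    (mapPeriods L e).G n = ∑' l : L.lattice, (e l ^ n)⁻¹ :=
  ((e.toEquiv.subtypeEquiv fun x ↦ (apply_mem_mapPeriods_iff L e x).symm).tsum_eq
    (fun l : (mapPeriods L e).lattice ↦ ((l : ℂ) ^ n)⁻¹)).symm

/-- The lattice `c Λ`. -/
def scalePeriods (L : PeriodPair) (c : ℂ) (hc : c ≠ 0) : PeriodPair :=
  mapPeriods L ((LinearEquiv.smulOfNeZero ℂ ℂ c hc).restrictScalars ℝ)

lemma mul_mem_scalePeriods_iff (L : PeriodPair) {c : ℂ} (hc : c ≠ 0) (x : ℂ) :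
    c * x ∈ (scalePeriods L c hc).lattice ↔ x ∈ L.lattice :=
  apply_mem_mapPeriods_iff L ((LinearEquiv.smulOfNeZero ℂ ℂ c hc).restrictScalars ℝ) x

lemma G_scalePeriods (L : PeriodPair) {c : ℂ} (hc : c ≠ 0) (n : ℕ) :
    (scalePeriods L c hc).G n = (c ^ n)⁻¹ * L.G n := by
  rw [scalePeriods, G_mapPeriods, PeriodPair.G, ← tsum_mul_left]
  simp [mul_pow, mul_comm]

/-- The complex conjugate of the lattice `Λ`. -/
def conjPeriods (L : PeriodPair) : PeriodPair :=
  mapPeriods L conjAe.toLinearEquiv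

lemma conj_mem_conjPeriods_iff (L : PeriodPair) (x : ℂ) :
    conj x ∈ (conjPeriods L).lattice ↔ x ∈ L.lattice :=
  apply_mem_mapPeriods_iff L conjAe.toLinearEquiv x

lemma mem_conjPeriods_iff (L : PeriodPair) (x : ℂ) :
    x ∈ (conjPeriods L).lattice ↔ conj x ∈ L.lattice := by
  simpa using conj_mem_conjPeriods_iff L (conj x)

lemma G_conjPeriods (L : PeriodPair) (n : ℕ) : (conjPeriods L).G n = conj (L.G n) := by
  rw [conjPeriods, G_mapPeriods, PeriodPair.G, conj_tsum]
  simp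

lemma G_congr {L₁ L₂ : PeriodPair} (h : L₁.lattice = L₂.lattice) (n : ℕ) : L₁.G n = L₂.G n := by
  rw [PeriodPair.G, PeriodPair.G, h]

/-- The `j`-invariant `1728 g₂³ / (g₂³ - 27 g₃²)` of a lattice. -/
def latticeJ (L : PeriodPair) : ℂ := 1728 * (L.g₂ ^ 3 / (L.g₂ ^ 3 - 27 * L.g₃ ^ 2))

lemma latticeJ_congr {L₁ L₂ : PeriodPair} (h : L₁.lattice = L₂.lattice) :
    latticeJ L₁ = latticeJ L₂ := by
  simp only [latticeJ, PeriodPair.g₂, PeriodPair.g₃, G_congr h]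

lemma latticeJ_scalePeriods (L : PeriodPair) {c : ℂ} (hc : c ≠ 0) :
    latticeJ (scalePeriods L c hc) = latticeJ L := by
  have h : (60 * ((c ^ 4)⁻¹ * L.G 4)) ^ 3 - 27 * (140 * ((c ^ 6)⁻¹ * L.G 6)) ^ 2 =
      (c ^ 12)⁻¹ * ((60 * L.G 4) ^ 3 - 27 * (140 * L.G 6) ^ 2) := by
    field_simp
  simp only [latticeJ, PeriodPair.g₂, PeriodPair.g₃, G_scalePeriods, h]
  rw [show (60 * ((c ^ 4)⁻¹ * L.G 4)) ^ 3 = (c ^ 12)⁻¹ * (60 * L.G 4) ^ 3 by field_simp,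
    mul_div_mul_left _ _ (by positivity)]

lemma latticeJ_conjPeriods (L : PeriodPair) : latticeJ (conjPeriods L) = conj (latticeJ L) := by
  simp only [latticeJ, PeriodPair.g₂, PeriodPair.g₃, G_conjPeriods, map_mul, map_div₀, map_sub,
    map_pow, map_ofNat]

lemma latticeCurve_Δ (L : PeriodPair) : (latticeCurve L).Δ = L.g₂ ^ 3 - 27 * L.g₃ ^ 2 := by
  simp only [latticeCurve, WeierstrassCurve.Δ, WeierstrassCurve.b₂, WeierstrassCurve.b₄,
    WeierstrassCurve.b₆, WeierstrassCurve.b₈]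
  ring

lemma latticeCurve_c₄ (L : PeriodPair) : (latticeCurve L).c₄ = 12 * L.g₂ := by
  simp only [latticeCurve, WeierstrassCurve.c₄, WeierstrassCurve.b₂, WeierstrassCurve.b₄]
  ring

lemma latticeCurve_c₆ (L : PeriodPair) : (latticeCurve L).c₆ = 216 * L.g₃ := by
  simp only [latticeCurve, WeierstrassCurve.c₆, WeierstrassCurve.b₂, WeierstrassCurve.b₄,
    WeierstrassCurve.b₆]
  ring

lemma latticeCurve_j (L : PeriodPair) [(latticeCurve L).IsElliptic] :
    (latticeCurve L).j = latticeJ L := by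
  rw [WeierstrassCurve.j, Units.val_inv_eq_inv_val, WeierstrassCurve.coe_Δ', latticeCurve_Δ,
    latticeCurve_c₄, latticeJ]
  ring

/-- Lattices with the same `j`-invariant are homothetic. -/
theorem exists_lattice_eq_scalePeriods {L₁ L₂ : PeriodPair} [(latticeCurve L₁).IsElliptic]
    [(latticeCurve L₂).IsElliptic] (h : latticeJ L₁ = latticeJ L₂) :
    ∃ (c : ℂ) (hc : c ≠ 0), L₂.lattice = (scalePeriods L₁ c hc).lattice := by
  obtain ⟨C, hC⟩ := WeierstrassCurve.exists_variableChange_of_j_eq (latticeCurve L₁)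
    (latticeCurve L₂) (by simpa [latticeCurve_j] using h)
  have h₄ := WeierstrassCurve.variableChange_c₄ (latticeCurve L₁) C
  have h₆ := WeierstrassCurve.variableChange_c₆ (latticeCurve L₁) C
  rw [hC, latticeCurve_c₄, latticeCurve_c₄, Units.val_inv_eq_inv_val] at h₄
  rw [hC, latticeCurve_c₆, latticeCurve_c₆, Units.val_inv_eq_inv_val] at h₆
  refine ⟨C.u, C.u.ne_zero, lattice_eq_of_g₂_eq_of_g₃_eq ?_ ?_⟩
  · simp only [PeriodPair.g₂, G_scalePeriods] at h₄ ⊢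
    linear_combination h₄ / 12
  · simp only [PeriodPair.g₃, G_scalePeriods] at h₆ ⊢
    linear_combination h₆ / 216

/-- The lattice `ℤ τ + ℤ`. -/
def tauPeriods (τ : ℍ) : PeriodPair where
  ω₁ := τ
  ω₂ := 1
  indep := by
    rw [LinearIndependent.pair_iff]
    intro s t h
    have h₁ := congrArg Complex.im h
    have h₂ := congrArg Complex.re h
    have := τ.im_ne_zero
    simp at h₁ h₂
    have hs : s = 0 := by tauto
    simp_all

lemma mem_tauPeriods (τ : ℍ) (x : ℂ) :
    x ∈ (tauPeriods τ).lattice ↔ ∃ m n : ℤ, m * (τ : ℂ) + n = x := by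
  simp [PeriodPair.mem_lattice, tauPeriods]

lemma G_tauPeriods (τ : ℍ) (k : ℕ) :
    (tauPeriods τ).G k = ∑' v : Fin 2 → ℤ, EisensteinSeries.eisSummand k v τ := by
  rw [← (finTwoArrowEquiv ℤ).symm.tsum_eq, PeriodPair.G,
    ← (tauPeriods τ).latticeEquivProd.symm.toEquiv.tsum_eq]
  refine tsum_congr fun x ↦ ?_
  have := PeriodPair.latticeEquiv_symm_apply (tauPeriods τ) x
  simp only [LinearEquiv.coe_toEquiv, this]
  simp [EisensteinSeries.eisSummand, tauPeriods]

lemma bernoulli_six : bernoulli 6 = 1 / 42 := by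
  rw [bernoulli_eq_bernoulli'_of_ne_one (by norm_num), bernoulli'_def]
  norm_num [Finset.sum_range_succ, bernoulli'_eq_zero_of_odd, Nat.choose]

lemma modularG₂_eq_g₂ (τ : ℍ) : modularG₂ τ = (tauPeriods τ).g₂ := by
  have h := tsum_eisSummand_eq_tsum_sigma_mul_cexp_pow (k := 4) (by norm_num) (by decide) τ
  have hζ := riemannZeta_four
  have h4 : ((-2 * Real.pi * I) ^ 4 : ℂ) = 16 * Real.pi ^ 4 := by
    rw [mul_pow, I_pow_four]; ring
  rw [PeriodPair.g₂, G_tauPeriods, h, h4, modularG₂]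
  push_cast
  rw [hζ]
  norm_num [Nat.factorial]
  ring

lemma modularG₃_eq_g₃ (τ : ℍ) : modularG₃ τ = (tauPeriods τ).g₃ := by
  have h := tsum_eisSummand_eq_tsum_sigma_mul_cexp_pow (k := 6) (by norm_num) (by decide) τ
  have hζ := riemannZeta_two_mul_nat (k := 3) (by norm_num)
  norm_num [bernoulli_six, Nat.factorial] at hζ
  have h6 : ((-2 * Real.pi * I) ^ 6 : ℂ) = -64 * Real.pi ^ 6 := by
    rw [mul_pow, show I ^ 6 = I ^ 4 * I ^ 2 by ring, I_pow_four, I_sq]; ring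
  rw [PeriodPair.g₃, G_tauPeriods, h, h6, modularG₃]
  push_cast
  rw [hζ]
  norm_num [Nat.factorial]
  ring

lemma latticeJ_tauPeriods (τ : ℍ) : latticeJ (tauPeriods τ) = modularJ τ := by
  rw [latticeJ, modularJ, modularDelta, modularG₂_eq_g₂, modularG₃_eq_g₃]

lemma E₄_eq_tsum (τ : ℍ) : ModularForm.E₄ τ =
    1 + 240 * ∑' n : ℕ+, (ArithmeticFunction.sigma 3 n : ℂ) *
      cexp (2 * Real.pi * I * τ) ^ (n : ℕ) := by
  have h := EisensteinSeries.q_expansion_bernoulli (k := 4) (by norm_num) (by decide) τ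
  rw [bernoulli_eq_bernoulli'_of_ne_one (by norm_num), bernoulli'_four] at h
  norm_num at h
  exact h

lemma E₆_eq_tsum (τ : ℍ) : ModularForm.E₆ τ =
    1 - 504 * ∑' n : ℕ+, (ArithmeticFunction.sigma 5 n : ℂ) *
      cexp (2 * Real.pi * I * τ) ^ (n : ℕ) := by
  have h := EisensteinSeries.q_expansion_bernoulli (k := 6) (by norm_num) (by decide) τ
  norm_num [bernoulli_six] at h
  exact h

/-- The discriminant of the definition is `(2π)¹²` times the cusp form `q ∏ (1 - qⁿ)²⁴`. -/
lemma modularDelta_eq (τ : ℍ) :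
    modularDelta τ = (2 * Real.pi) ^ 12 * ModularForm.discriminant τ := by
  rw [ModularForm.discriminant_eq_E₄_cube_sub_E₆_sq, modularDelta, modularG₂, modularG₃,
    E₄_eq_tsum, E₆_eq_tsum]
  ring

lemma modularDelta_ne_zero (τ : ℍ) : modularDelta τ ≠ 0 := by
  rw [modularDelta_eq]
  exact mul_ne_zero (pow_ne_zero _ (by simp [Real.pi_ne_zero])) (ModularForm.discriminant_ne_zero τ)

/-- In the normalized notation, `j = E₄³ / Δ`. -/
lemma modularJ_eq (τ : ℍ) :
    modularJ τ = ModularForm.E₄ τ ^ 3 / ModularForm.discriminant τ := by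
  have hπ : (Real.pi : ℂ) ≠ 0 := by simp [Real.pi_ne_zero]
  have := ModularForm.discriminant_ne_zero τ
  rw [modularJ, modularDelta_eq, modularG₂, E₄_eq_tsum]
  field_simp
  ring

lemma mem_scalePeriods_iff (L : PeriodPair) {c : ℂ} (hc : c ≠ 0) (x : ℂ) :
    x ∈ (scalePeriods L c hc).lattice ↔ x / c ∈ L.lattice := by
  rw [← mul_mem_scalePeriods_iff L hc, mul_div_cancel₀ _ hc]

lemma mem_scalePeriods_tauPeriods (τ : ℍ) {c : ℂ} (hc : c ≠ 0) (x : ℂ) :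
    x ∈ (scalePeriods (tauPeriods τ) c hc).lattice ↔ ∃ m n : ℤ, c * (m * τ + n) = x := by
  simp only [mem_scalePeriods_iff, mem_tauPeriods, eq_div_iff hc, mul_comm c]

/-- A vector of `Λ` with coprime coordinates is the first vector of a basis of `Λ`. -/
lemma exists_lattice_eq_scalePeriods_tauPeriods (L : PeriodPair) {m n : ℤ} (h : IsCoprime m n) :
    ∃ (hv : m * L.ω₁ + n * L.ω₂ ≠ 0) (τ : ℍ),
      L.lattice = (scalePeriods (tauPeriods τ) (m * L.ω₁ + n * L.ω₂) hv).lattice := by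
  obtain ⟨a, b, hab⟩ := h
  have habC : (a : ℂ) * m + b * n = 1 := by exact_mod_cast hab
  have habR : (a : ℝ) * m + b * n = 1 := by exact_mod_cast hab
  have hv : m * L.ω₁ + n * L.ω₂ ≠ 0 := by
    intro h0
    obtain ⟨h₁, h₂⟩ := LinearIndependent.pair_iff.mp L.indep m n (by simpa using h0)
    simp [h₁, h₂] at habR
  set v := m * L.ω₁ + n * L.ω₂ with hvdef
  -- the matrix with rows `(m, n)` and `(-b, a)` is unimodular
  set w := -b * L.ω₁ + a * L.ω₂ with hwdef
  have hmem (x : ℂ) : x ∈ L.lattice ↔ ∃ k l : ℤ, k * v + l * w = x := by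
    rw [PeriodPair.mem_lattice]
    constructor
    · rintro ⟨i, j, rfl⟩
      refine ⟨a * i + b * j, m * j - n * i, ?_⟩
      push_cast
      rw [hvdef, hwdef]
      linear_combination (i * L.ω₁ + j * L.ω₂) * habC
    · rintro ⟨k, l, rfl⟩
      refine ⟨k * m - l * b, k * n + l * a, ?_⟩
      push_cast
      rw [hvdef, hwdef]
      ring
  have him : (w / v).im ≠ 0 := by
    intro h0
    have hr : w = ((w / v).re : ℂ) * v := by
      rw [← div_eq_iff hv]
      exact Complex.ext rfl (by simpa using h0)
    set r := (w / v).re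
    obtain ⟨h₁, h₂⟩ := LinearIndependent.pair_iff.mp L.indep (-b - r * m) (a - r * n) (by
      simp only [real_smul]
      push_cast
      rw [hvdef] at hr
      linear_combination hr)
    have : (a : ℝ) * m + b * n = 0 := by linear_combination -n * h₁ + m * h₂
    linarith
  -- `e` is the sign that puts `τ = e w / v` into the upper half-plane
  obtain ⟨τ, e, he, hτ⟩ : ∃ (τ : ℍ) (e : ℤ), e * e = 1 ∧ (τ : ℂ) * v = e * w := by
    rcases lt_or_gt_of_ne him with h | h
    · exact ⟨⟨-(w / v), by simpa using h⟩, -1, by norm_num, by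
        change -(w / v) * v = _
        field_simp
        push_cast
        ring⟩
    · exact ⟨⟨w / v, h⟩, 1, by norm_num, by
        change (w / v) * v = _
        field_simp
        push_cast
        ring⟩
  have heC : (e : ℂ) * e = 1 := by exact_mod_cast he
  refine ⟨hv, τ, Submodule.ext fun x ↦ ?_⟩
  rw [hmem, mem_scalePeriods_tauPeriods]
  constructor
  · rintro ⟨k, l, rfl⟩
    refine ⟨l * e, k, ?_⟩
    push_cast
    linear_combination l * e * hτ + l * w * heC
  · rintro ⟨k, l, rfl⟩
    refine ⟨l, k * e, ?_⟩
    push_cast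
    linear_combination -k * hτ

/-- The discriminant of a lattice does not vanish, since `Δ` has no zeros. -/
lemma latticeCurve_isElliptic (L : PeriodPair) : (latticeCurve L).IsElliptic := by
  obtain ⟨hv, τ, h⟩ := exists_lattice_eq_scalePeriods_tauPeriods L isCoprime_one_left (n := 0)
  refine ⟨isUnit_iff_ne_zero.mpr ?_⟩
  set v := ((1 : ℤ) : ℂ) * L.ω₁ + ((0 : ℤ) : ℂ) * L.ω₂
  have hΔ : (latticeCurve L).Δ = (v ^ 12)⁻¹ * modularDelta τ := by
    rw [latticeCurve_Δ, modularDelta, modularG₂_eq_g₂, modularG₃_eq_g₃]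
    simp only [PeriodPair.g₂, PeriodPair.g₃, G_congr h, G_scalePeriods]
    field_simp
    simp only [v]
    ring
  rw [hΔ]
  exact mul_ne_zero (inv_ne_zero (pow_ne_zero _ hv)) (modularDelta_ne_zero τ)

/-! ### The size of `j` at the two points -/

/-- Comparison with a geometric series through `σ₃(n + 1) ≤ (n + 1)⁴ ≤ 16ⁿ`. -/
lemma abs_tsum_sigma_three_le {q : ℝ} (hq : |q| < 1 / 16) :
    |∑' n : ℕ+, (ArithmeticFunction.sigma 3 n : ℝ) * q ^ (n : ℕ)| ≤ |q| * (1 - 16 * |q|)⁻¹ := by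
  rw [tsum_pnat_eq_tsum_succ (f := fun n ↦ (ArithmeticFunction.sigma 3 n : ℝ) * q ^ n)]
  rw [← Real.norm_eq_abs]
  refine tsum_of_norm_bounded ((hasSum_geometric_of_lt_one (r := 16 * |q|) (by positivity)
    (by linarith)).mul_left |q|) fun n ↦ ?_
  have h₁ : (ArithmeticFunction.sigma 3 (n + 1) : ℝ) ≤ ((n + 1) ^ 4 : ℕ) := by
    exact_mod_cast ArithmeticFunction.sigma_le_pow_succ 3 (n + 1)
  have h₂ : ∀ n : ℕ, (n + 1) ^ 4 ≤ 16 ^ n := by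
    intro n
    have : n + 1 ≤ 2 ^ n := Nat.lt_two_pow_self
    calc (n + 1) ^ 4 ≤ (2 ^ n) ^ 4 := Nat.pow_le_pow_left this 4
      _ = 16 ^ n := by rw [← pow_mul, mul_comm, pow_mul]; norm_num
  have h₃ : (ArithmeticFunction.sigma 3 (n + 1) : ℝ) ≤ 16 ^ n :=
    h₁.trans (by exact_mod_cast h₂ n)
  calc ‖(ArithmeticFunction.sigma 3 (n + 1) : ℝ) * q ^ (n + 1)‖
      = (ArithmeticFunction.sigma 3 (n + 1) : ℝ) * |q| ^ (n + 1) := by simp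
    _ ≤ 16 ^ n * |q| ^ (n + 1) := by gcongr
    _ = |q| * (16 * |q|) ^ n := by ring

lemma E₄_eq_ofReal {τ : ℍ} {q : ℝ} (hτ : cexp (2 * Real.pi * I * τ) = q) :
    ModularForm.E₄ τ =
      ((1 + 240 * ∑' n : ℕ+, (ArithmeticFunction.sigma 3 n : ℝ) * q ^ (n : ℕ) : ℝ) : ℂ) := by
  rw [E₄_eq_tsum, hτ]
  push_cast
  rfl

lemma multipliable_one_sub_pow_succ {q : ℝ} (hq : |q| < 1) :
    Multipliable fun n : ℕ ↦ (1 - q ^ (n + 1)) := by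
  simp_rw [sub_eq_add_neg]
  refine multipliable_one_add_of_summable ?_
  simp only [norm_neg, Real.norm_eq_abs, pow_succ, abs_mul, abs_pow]
  exact (summable_geometric_of_lt_one (abs_nonneg q) hq).mul_right _

lemma discriminant_eq_ofReal {τ : ℍ} {q : ℝ} (hτ : cexp (2 * Real.pi * I * τ) = q)
    (hq : |q| < 1) :
    ModularForm.discriminant τ = ((q * (∏' n : ℕ, (1 - q ^ (n + 1))) ^ 24 : ℝ) : ℂ) := by
  have hm := multipliable_one_sub_pow_succ hq
  have h : ModularForm.discriminant τ = q * ∏' n : ℕ, (1 - (q : ℂ) ^ (n + 1)) ^ 24 := by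
    rw [ModularForm.discriminant_eq_q_prod]
    simp [ModularForm.eta_q, Function.Periodic.qParam, hτ]
  have h' : ∏' n : ℕ, (1 - (q : ℂ) ^ (n + 1)) ^ 24 =
      ((∏' n : ℕ, (1 - q ^ (n + 1)) ^ 24 : ℝ) : ℂ) := by
    have := (hm.pow 24).map_tprod Complex.ofRealHom Complex.continuous_ofReal
    simpa using this.symm
  rw [h, h', hm.tprod_pow]
  push_cast
  rfl

/-- If `q = exp (2πiτ)` is real and positive, then `j(τ)` is real and at least `q⁻¹`. -/
lemma exists_modularJ_eq_ofReal_ge {τ : ℍ} {q : ℝ} (hτ : cexp (2 * Real.pi * I * τ) = q)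
    (hq : 0 < q) (hq1 : q < 1) : ∃ x : ℝ, modularJ τ = x ∧ q⁻¹ ≤ x := by
  have hq' : |q| < 1 := by rwa [abs_of_pos hq]
  have hE := E₄_eq_ofReal hτ
  have hD := discriminant_eq_ofReal hτ hq'
  have hne := ModularForm.discriminant_ne_zero τ
  set S := ∑' n : ℕ+, (ArithmeticFunction.sigma 3 n : ℝ) * q ^ (n : ℕ)
  set P := ∏' n : ℕ, (1 - q ^ (n + 1)) with hP
  have hS : 0 ≤ S := tsum_nonneg fun n ↦ by positivity
  have hlim := (multipliable_one_sub_pow_succ hq').hasProd.tendsto_prod_nat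
  have hfac (n : ℕ) : 0 ≤ 1 - q ^ (n + 1) ∧ 1 - q ^ (n + 1) ≤ 1 :=
    ⟨sub_nonneg.mpr (pow_le_one₀ hq.le hq1.le), sub_le_self _ (by positivity)⟩
  have hP0 : 0 ≤ P := ge_of_tendsto' hlim fun n ↦ Finset.prod_nonneg fun i _ ↦ (hfac i).1
  have hP1 : P ≤ 1 := le_of_tendsto' hlim fun n ↦
    Finset.prod_le_one (fun i _ ↦ (hfac i).1) fun i _ ↦ (hfac i).2
  have hPne : P ≠ 0 := by
    intro h
    rw [hD, h] at hne
    simp at hne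
  have hP24 : 0 < P ^ 24 := pow_pos (hP0.lt_of_ne' hPne) _
  refine ⟨(1 + 240 * S) ^ 3 / (q * P ^ 24), ?_, ?_⟩
  · rw [modularJ_eq, hE, hD]
    push_cast
    rfl
  · rw [inv_eq_one_div, div_le_div_iff₀ hq (by positivity)]
    have h₁ : P ^ 24 ≤ 1 := pow_le_one₀ hP0 hP1
    have h₂ : 1 ≤ (1 + 240 * S) ^ 3 := one_le_pow₀ (by linarith)
    nlinarith

/-- If `exp (2πiτ) = -r` with a small `r > 0`, then `j(τ)` is real and at most `-1 / (20 r)`. -/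
lemma exists_modularJ_eq_ofReal_le {τ : ℍ} {r : ℝ}
    (hτ : cexp (2 * Real.pi * I * τ) = ((-r : ℝ) : ℂ))
    (hr : 0 < r) (hr1 : r ≤ 1 / 5000) : ∃ x : ℝ, modularJ τ = x ∧ x ≤ -(1 / (20 * r)) := by
  have habs : |-r| = r := by rw [abs_neg, abs_of_pos hr]
  have hq' : |-r| < 1 := by rw [habs]; linarith
  have hE := E₄_eq_ofReal hτ
  have hD := discriminant_eq_ofReal hτ hq'
  have hne := ModularForm.discriminant_ne_zero τ
  have hS := abs_tsum_sigma_three_le (q := -r) (by rw [habs]; linarith)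
  set S := ∑' n : ℕ+, (ArithmeticFunction.sigma 3 n : ℝ) * (-r) ^ (n : ℕ)
  set P := ∏' n : ℕ, (1 - (-r) ^ (n + 1)) with hP
  have hS' : -(1 / 4000) ≤ S := by
    rw [habs] at hS
    have : r * (1 - 16 * r)⁻¹ ≤ 1 / 4000 := by
      rw [← div_eq_mul_inv, div_le_iff₀ (by linarith)]
      linarith
    linarith [neg_abs_le S]
  have hlim := (multipliable_one_sub_pow_succ hq').hasProd.tendsto_prod_nat
  have hpow (n : ℕ) : |(-r) ^ (n + 1)| = r ^ (n + 1) := by rw [abs_pow, habs]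
  have hfac0 (n : ℕ) : 0 ≤ 1 - (-r) ^ (n + 1) := by
    have := le_abs_self ((-r) ^ (n + 1))
    have h1 : r ^ (n + 1) ≤ 1 := pow_le_one₀ hr.le (by linarith)
    linarith [hpow n]
  have hfac (n : ℕ) : 1 - (-r) ^ (n + 1) ≤ Real.exp (r ^ (n + 1)) := by
    have := neg_abs_le ((-r) ^ (n + 1))
    linarith [hpow n, Real.add_one_le_exp (r ^ (n + 1))]
  have hP0 : 0 ≤ P := ge_of_tendsto' hlim fun n ↦ Finset.prod_nonneg fun i _ ↦ hfac0 i
  have hgeom : ∀ n : ℕ, ∑ i ∈ Finset.range n, r ^ (i + 1) ≤ 1 / 24 := by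
    intro n
    have := (summable_geometric_of_lt_one hr.le (by linarith)).sum_le_tsum (Finset.range n)
      fun i _ ↦ (by positivity : 0 ≤ r ^ i)
    rw [tsum_geometric_of_lt_one hr.le (by linarith)] at this
    simp_rw [pow_succ, ← Finset.sum_mul]
    calc (∑ i ∈ Finset.range n, r ^ i) * r ≤ (1 - r)⁻¹ * r := by gcongr
      _ ≤ 1 / 24 := by
        rw [inv_mul_eq_div, div_le_iff₀ (by linarith)]
        linarith
  have hP1 : P ≤ Real.exp (1 / 24) := le_of_tendsto' hlim fun n ↦ by
    calc ∏ i ∈ Finset.range n, (1 - (-r) ^ (i + 1))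
        ≤ ∏ i ∈ Finset.range n, Real.exp (r ^ (i + 1)) :=
          Finset.prod_le_prod (fun i _ ↦ hfac0 i) fun i _ ↦ hfac i
      _ = Real.exp (∑ i ∈ Finset.range n, r ^ (i + 1)) := (Real.exp_sum _ _).symm
      _ ≤ Real.exp (1 / 24) := Real.exp_le_exp.mpr (hgeom n)
  have hPne : P ≠ 0 := by
    intro h
    rw [hD, h] at hne
    simp at hne
  have hP24 : 0 < P ^ 24 := pow_pos (hP0.lt_of_ne' hPne) _
  have hP3 : P ^ 24 ≤ 3 := by
    calc P ^ 24 ≤ Real.exp (1 / 24) ^ 24 := by gcongr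
      _ = Real.exp 1 := by rw [← Real.exp_nat_mul]; norm_num
      _ ≤ 3 := by linarith [Real.exp_one_lt_d9]
  refine ⟨(1 + 240 * S) ^ 3 / (-r * P ^ 24), ?_, ?_⟩
  · rw [modularJ_eq, hE, hD]
    push_cast
    rfl
  · rw [neg_mul, div_neg, neg_le_neg_iff, div_le_div_iff₀ (by positivity) (by positivity)]
    have h₂ : (9 / 10 : ℝ) ^ 3 ≤ (1 + 240 * S) ^ 3 := by
      gcongr
      linarith
    nlinarith

lemma cexp_sqrtNeg (n : ℕ) (hn : 0 < n) :
    cexp (2 * Real.pi * I * (sqrtNeg n hn : ℂ)) = (Real.exp (-(2 * Real.pi * √n)) : ℝ) := by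
  rw [ofReal_exp]
  congr 1
  change 2 * Real.pi * I * (I * (√n : ℂ)) = _
  push_cast
  linear_combination 2 * Real.pi * (√n : ℂ) * I_mul_I

lemma cexp_halfOneAddSqrtNeg (n : ℕ) (hn : 0 < n) :
    cexp (2 * Real.pi * I * (halfOneAddSqrtNeg n hn : ℂ)) =
      ((-Real.exp (-(Real.pi * √n)) : ℝ) : ℂ) := by
  rw [show 2 * Real.pi * I * (halfOneAddSqrtNeg n hn : ℂ) =
      Real.pi * I + ((-(Real.pi * √n) : ℝ) : ℂ) by
    change 2 * Real.pi * I * ((1 + I * (√n : ℂ)) / 2) = _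
    push_cast
    linear_combination Real.pi * (√n : ℂ) * I_mul_I]
  rw [Complex.exp_add, exp_pi_mul_I, ← ofReal_exp]
  simp

lemma lt_exp_of_jBound_lt {y : ℝ} {n : ℕ} (h : jBound y < n) :
    y < Real.exp (2 * Real.pi * √n) := by
  rcases le_or_gt y 0 with hy | hy
  · exact hy.trans_lt (Real.exp_pos _)
  · rw [jBound, if_pos hy] at h
    have h₁ := Real.lt_sqrt_of_sq_lt h
    rw [div_lt_iff₀ (by positivity)] at h₁
    rw [← Real.log_lt_iff_lt_exp hy]
    linarith

lemma neg_exp_div_lt_of_jBound_lt {y : ℝ} {n : ℕ} (h : jBound y < n) :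
    -(Real.exp (Real.pi * √n) / 20) < y := by
  have h0 := Real.exp_pos (Real.pi * √n)
  rcases le_or_gt 0 y with hy | hy
  · linarith
  · rw [jBound, if_neg hy.not_gt, if_pos hy] at h
    have h₁ := Real.lt_sqrt_of_sq_lt h
    rw [← lt_sub_iff_add_lt, div_lt_iff₀ Real.pi_pos,
      Real.log_lt_iff_lt_exp (abs_pos.mpr hy.ne), abs_of_neg hy] at h₁
    have h₂ : Real.exp ((√n - 1) * Real.pi) = Real.exp (Real.pi * √n) / Real.exp Real.pi := by
      rw [← Real.exp_sub]
      ring_nf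
    have h₃ : 20 ≤ Real.exp Real.pi := by
      calc (20 : ℝ) ≤ 2.718 ^ 3 := by norm_num
        _ ≤ Real.exp 1 ^ 3 := by
          gcongr
          linarith [Real.exp_one_gt_d9]
        _ = Real.exp 3 := by rw [← Real.exp_nat_mul]; norm_num
        _ ≤ Real.exp Real.pi := Real.exp_le_exp.mpr Real.pi_gt_three.le
    have h₄ : Real.exp (Real.pi * √n) / Real.exp Real.pi ≤ Real.exp (Real.pi * √n) / 20 := by
      gcongr
    linarith

/-- `j(√-n)` is real and exceeds every real number whose bound is less than `n`. -/
lemma exists_modularJ_sqrtNeg {y : ℝ} {n : ℕ} (hn : 0 < n) (h : jBound y < n) :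
    ∃ x : ℝ, modularJ (sqrtNeg n hn) = x ∧ y < x := by
  have hs : 0 < √(n : ℝ) := Real.sqrt_pos.mpr (by exact_mod_cast hn)
  obtain ⟨x, hx, hx'⟩ := exists_modularJ_eq_ofReal_ge (cexp_sqrtNeg n hn) (Real.exp_pos _)
    (by rw [Real.exp_lt_one_iff]; have := Real.pi_pos; nlinarith [mul_pos this hs])
  refine ⟨x, hx, (lt_exp_of_jBound_lt h).trans_le ?_⟩
  rwa [Real.exp_neg, inv_inv] at hx'

/-- `j((1 + √-n) / 2)` is real and less than every real number whose bound is less than `n`. -/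
lemma exists_modularJ_halfOneAddSqrtNeg {y : ℝ} {n : ℕ} (hn : 0 < n) (hn9 : 9 ≤ n)
    (h : jBound y < n) : ∃ x : ℝ, modularJ (halfOneAddSqrtNeg n hn) = x ∧ x < y := by
  have hs : 3 ≤ √(n : ℝ) := Real.le_sqrt_of_sq_le (by norm_num; exact_mod_cast hn9)
  have he : (5000 : ℝ) ≤ Real.exp (Real.pi * √n) := by
    calc (5000 : ℝ) ≤ 2.7 ^ 9 := by norm_num
      _ ≤ Real.exp 1 ^ 9 := by
        gcongr
        linarith [Real.exp_one_gt_d9]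
      _ = Real.exp 9 := by rw [← Real.exp_nat_mul]; norm_num
      _ ≤ Real.exp (Real.pi * √n) := Real.exp_le_exp.mpr (by nlinarith [Real.pi_gt_three])
  obtain ⟨x, hx, hx'⟩ := exists_modularJ_eq_ofReal_le (cexp_halfOneAddSqrtNeg n hn)
    (Real.exp_pos _) (by
      rw [Real.exp_neg, inv_eq_one_div]
      exact one_div_le_one_div_of_le (by norm_num) he)
  refine ⟨x, hx, hx'.trans_lt ((neg_exp_div_lt_of_jBound_lt h).trans_eq' ?_)⟩
  rw [Real.exp_neg]
  field_simp

/-! ### Endomorphisms of complex tori -/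

/-- The ring of multipliers `α` of the lattice `Λ`, that is, those with `α Λ ⊆ Λ`. -/
def multiplierRing (L : PeriodPair) : Subring ℂ where
  carrier := {α | ∀ x ∈ L.lattice, α * x ∈ L.lattice}
  zero_mem' x _ := by simp
  one_mem' x hx := by simpa using hx
  add_mem' {α β} hα hβ x hx := by
    rw [add_mul]
    exact add_mem (hα x hx) (hβ x hx)
  neg_mem' {α} hα x hx := by
    rw [neg_mul]
    exact neg_mem (hα x hx)
  mul_mem' {α β} hα hβ x hx := by
    rw [mul_assoc]
    exact hα _ (hβ x hx)

lemma mem_multiplierRing {L : PeriodPair} {α : ℂ} :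
    α ∈ multiplierRing L ↔ ∀ x ∈ L.lattice, α * x ∈ L.lattice := Iff.rfl

lemma mkQ_eq_zero_iff (L : PeriodPair) (x : ℂ) : L.lattice.mkQ x = 0 ↔ x ∈ L.lattice := by
  simp

/-- Multiplication by a multiplier of `Λ`, as an endomorphism of `ℂ / Λ`. -/
def multiplicationEnd (L : PeriodPair) : multiplierRing L →+* torusEnd L where
  toFun α := ⟨(L.lattice.mapQ L.lattice (LinearMap.mulLeft ℤ (α : ℂ)) α.2).toAddMonoidHom,
    fun z ↦ ⟨fun w ↦ α * w, by fun_prop, .of_forall fun w ↦ rfl⟩⟩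
  map_zero' := by
    ext x
    obtain ⟨w, rfl⟩ := L.lattice.mkQ_surjective x
    change L.lattice.mkQ (0 * w) = 0
    simp
  map_one' := by
    ext x
    obtain ⟨w, rfl⟩ := L.lattice.mkQ_surjective x
    change L.lattice.mkQ (1 * w) = L.lattice.mkQ w
    simp
  map_add' α β := by
    ext x
    obtain ⟨w, rfl⟩ := L.lattice.mkQ_surjective x
    change L.lattice.mkQ ((α + β) * w) = L.lattice.mkQ (α * w) + L.lattice.mkQ (β * w)
    rw [add_mul, map_add]
  map_mul' α β := by
    ext x
    obtain ⟨w, rfl⟩ := L.lattice.mkQ_surjective x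
    change L.lattice.mkQ ((α * β) * w) = L.lattice.mkQ (α * (β * w))
    rw [mul_assoc]

lemma multiplicationEnd_apply (L : PeriodPair) (α : multiplierRing L) (w : ℂ) :
    (multiplicationEnd L α : AddMonoid.End (ℂ ⧸ L.lattice)) (L.lattice.mkQ w) =
      L.lattice.mkQ (α * w) := rfl

lemma multiplicationEnd_injective (L : PeriodPair) :
    Function.Injective (multiplicationEnd L) := by
  rw [injective_iff_map_eq_zero]
  intro α hα
  by_contra hne
  have hne' : (α : ℂ) ≠ 0 := fun h ↦ hne (Subtype.ext h)
  have h := multiplicationEnd_apply L α (L.ω₁ / 2 / α)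
  rw [hα, mul_div_cancel₀ _ hne'] at h
  exact L.ω₁_div_two_notMem_lattice ((mkQ_eq_zero_iff L _).mp h.symm)

/-- A holomorphic germ `g` at `0` that vanishes there and satisfies `g(w) = 2 g(w / 2)` is
linear. -/
lemma eventually_eq_deriv_mul {g : ℂ → ℂ} (hg : DifferentiableAt ℂ g 0) (hg0 : g 0 = 0)
    (h : ∀ᶠ w in 𝓝 0, g w = 2 * g (w / 2)) : ∀ᶠ w in 𝓝 0, g w = deriv g 0 * w := by
  obtain ⟨δ, hδ, hball⟩ := Metric.eventually_nhds_iff_ball.mp h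
  refine Metric.eventually_nhds_iff_ball.mpr ⟨δ, hδ, fun w hw ↦ ?_⟩
  have hiter (n : ℕ) : g w = 2 ^ n * g (w / 2 ^ n) := by
    induction n with
    | zero => simp
    | succ n ih =>
      rw [ih, hball (w / 2 ^ n), pow_succ, div_div, mul_assoc]
      rw [mem_ball_zero_iff] at hw ⊢
      refine lt_of_le_of_lt ?_ hw
      rw [norm_div, norm_pow, Complex.norm_ofNat]
      exact div_le_self (norm_nonneg _) (one_le_pow₀ one_le_two)
  have hlim := hg.hasDerivAt.hasFDerivAt.lim w (c := fun n : ℕ ↦ (2 : ℂ) ^ n) (l := atTop) (by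
    simp only [norm_pow, Complex.norm_ofNat]
    exact tendsto_pow_atTop_atTop_of_one_lt one_lt_two)
  simp only [zero_add, hg0, sub_zero, smul_eq_mul, inv_mul_eq_div, ← hiter] at hlim
  simpa [mul_comm] using tendsto_nhds_unique tendsto_const_nhds hlim

/-- A holomorphic endomorphism lifts near `0` to a germ `g` with `g(0) = 0`. As the lattice is
discrete, additivity modulo `Λ` makes `g` satisfy `g(w) = 2 g(w / 2)`, so `g` is multiplication by
some `α`; additivity carries this from a neighbourhood of `0` to `ℂ`. -/
lemma multiplicationEnd_surjective (L : PeriodPair) :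
    Function.Surjective (multiplicationEnd L) := by
  rintro ⟨φ, hφ⟩
  obtain ⟨f, hf, hf'⟩ := hφ 0
  have hf0 : L.lattice.mkQ (f 0) = 0 := by rw [← hf'.self_of_nhds, map_zero, map_zero]
  let g : ℂ → ℂ := fun w ↦ f w - f 0
  have hg : AnalyticAt ℂ g 0 := hf.sub analyticAt_const
  have hg' : ∀ᶠ w in 𝓝 0, φ (L.lattice.mkQ w) = L.lattice.mkQ (g w) := by
    filter_upwards [hf'] with w hw
    rw [hw, map_sub, hf0, sub_zero]
  have hhalf : Tendsto (fun w : ℂ ↦ w / 2) (𝓝 0) (𝓝 0) := by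
    have : ContinuousAt (fun w : ℂ ↦ w / 2) 0 := by fun_prop
    simpa [ContinuousAt] using this
  have hgh : ContinuousAt (fun w : ℂ ↦ g w - 2 * g (w / 2)) 0 := by
    have h₁ : ContinuousAt (fun w : ℂ ↦ g (w / 2)) 0 :=
      ContinuousAt.comp_of_eq hg.continuousAt (by fun_prop) (by simp)
    exact hg.continuousAt.sub (continuousAt_const.mul h₁)
  have hdouble : ∀ᶠ w in 𝓝 0, g w = 2 * g (w / 2) := by
    have hnhds := L.compl_lattice_sdiff_singleton_mem_nhds 0
    rw [show (0 : ℂ) = g 0 - 2 * g (0 / 2) by simp [g]] at hnhds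
    filter_upwards [hg', hhalf.eventually hg', hgh hnhds] with w h₁ h₂ h₃
    have hmem : g w - 2 * g (w / 2) ∈ L.lattice := by
      rw [← mkQ_eq_zero_iff, map_sub, two_mul, map_add, ← h₁, ← h₂, ← map_add, ← map_add,
        add_halves, sub_self]
    by_contra hne
    exact h₃ ⟨hmem, fun h ↦ hne (sub_eq_zero.mp (h.trans (by simp [g])))⟩
  have hlin := eventually_eq_deriv_mul hg.differentiableAt (sub_self _) hdouble
  set α := deriv g 0
  have key (z : ℂ) : φ (L.lattice.mkQ z) = L.lattice.mkQ (α * z) := by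
    have hlim : Tendsto (fun n : ℕ ↦ z / ((n + 1 : ℕ) : ℂ)) atTop (𝓝 0) :=
      (tendsto_const_div_atTop_nhds_zero_nat z).comp (tendsto_add_atTop_nat 1)
    obtain ⟨n, h₁, h₂⟩ := (hlim.eventually (hg'.and hlin)).exists
    have hn : ((n + 1 : ℕ) : ℂ) ≠ 0 := Nat.cast_ne_zero.mpr n.succ_ne_zero
    have hz : z = (n + 1) • (z / ((n + 1 : ℕ) : ℂ)) := by
      rw [nsmul_eq_mul, mul_div_cancel₀ _ hn]
    rw [h₂] at h₁
    conv_lhs => rw [hz, map_nsmul, map_nsmul, h₁, ← map_nsmul, nsmul_eq_mul]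
    congr 1
    field_simp
  refine ⟨⟨α, fun x hx ↦ ?_⟩, ?_⟩
  · rw [← mkQ_eq_zero_iff] at hx
    rw [← mkQ_eq_zero_iff, ← key, hx, map_zero]
  · ext x
    obtain ⟨w, rfl⟩ := L.lattice.mkQ_surjective x
    rw [multiplicationEnd_apply]
    exact (key w).symm

/-- Every holomorphic endomorphism of `ℂ / Λ` is the multiplication by a multiplier of `Λ`. -/
def multiplierRingEquiv (L : PeriodPair) : multiplierRing L ≃+* torusEnd L :=
  .ofBijective _ ⟨multiplicationEnd_injective L, multiplicationEnd_surjective L⟩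

/-- The generator `(D + √-D) / 2` of the order `quadraticOrder D`. -/
def orderGen (D : ℕ) : ℂ := ((D : ℂ) + I * (√(D : ℝ) : ℂ)) / 2

@[simp] lemma orderGen_re (D : ℕ) : (orderGen D).re = D / 2 := by simp [orderGen]

@[simp] lemma orderGen_im (D : ℕ) : (orderGen D).im = √(D : ℝ) / 2 := by simp [orderGen]

lemma conj_orderGen (D : ℕ) : (starRingEnd ℂ) (orderGen D) = D - orderGen D := by
  apply Complex.ext
  · simp
    ring
  · simp

lemma orderGen_mul_self {D : ℕ} {N : ℤ} (hN : 4 * N = D * (D + 1)) :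
    orderGen D * orderGen D = D * orderGen D - N := by
  have hs : ((√(D : ℝ) : ℝ) : ℂ) * (√(D : ℝ) : ℝ) = D := by
    rw [← ofReal_mul, Real.mul_self_sqrt (Nat.cast_nonneg D)]
    simp
  have hN' : (4 : ℂ) * N = D * (D + 1) := by exact_mod_cast hN
  rw [orderGen]
  linear_combination (√(D : ℝ) : ℂ) * (√(D : ℝ) : ℂ) / 4 * I_mul_I - hs / 4 + hN' / 4

lemma mem_quadraticOrder {D : ℕ} {N : ℤ} (hN : 4 * N = D * (D + 1)) {x : ℂ} :
    x ∈ quadraticOrder D ↔ ∃ a b : ℤ, a + b * orderGen D = x := by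
  constructor
  · intro hx
    induction hx using Algebra.adjoin_induction with
    | mem x hx => exact ⟨0, 1, by rw [Set.mem_singleton_iff.mp hx, orderGen]; simp⟩
    | algebraMap r => exact ⟨r, 0, by simp⟩
    | add x y _ _ hx hy =>
      obtain ⟨a, b, rfl⟩ := hx
      obtain ⟨c, d, rfl⟩ := hy
      exact ⟨a + c, b + d, by push_cast; ring⟩
    | mul x y _ _ hx hy =>
      obtain ⟨a, b, rfl⟩ := hx
      obtain ⟨c, d, rfl⟩ := hy
      refine ⟨a * c - b * d * N, a * d + b * c + b * d * D, ?_⟩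
      push_cast
      linear_combination -(b * d : ℂ) * orderGen_mul_self hN
  · rintro ⟨a, b, rfl⟩
    have hω : orderGen D ∈ quadraticOrder D := Algebra.subset_adjoin rfl
    refine add_mem (intCast_mem _ a) (mul_mem (intCast_mem _ b) hω)

lemma orderGen_mem (D : ℕ) : orderGen D ∈ quadraticOrder D := Algebra.subset_adjoin rfl

/-- A subring of `ℂ` isomorphic to `ℤ[(D + √-D) / 2]` equals it, since the only conjugate of
`(D + √-D) / 2` is `(D - √-D) / 2`. -/
lemma nonempty_quadraticOrder_equiv_iff {D : ℕ} {N : ℤ} (hN : 4 * N = D * (D + 1))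
    (L : PeriodPair) : Nonempty (quadraticOrder D ≃+* torusEnd L) ↔
      ∀ α, α ∈ multiplierRing L ↔ α ∈ quadraticOrder D := by
  constructor
  · rintro ⟨e⟩
    let f : quadraticOrder D ≃+* multiplierRing L := e.trans (multiplierRingEquiv L).symm
    let ω : quadraticOrder D := ⟨orderGen D, orderGen_mem D⟩
    have hω : ω * ω = D * ω - N := Subtype.ext (by simpa using orderGen_mul_self hN)
    have hfω : (f ω : ℂ) * f ω = D * f ω - N := by
      have := congrArg (fun x ↦ (f x : ℂ)) hω
      simpa using this
    have hfω' : (f ω : ℂ) = orderGen D ∨ (f ω : ℂ) = D - orderGen D := by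
      have : ((f ω : ℂ) - orderGen D) * (f ω - (D - orderGen D)) = 0 := by
        linear_combination hfω - orderGen_mul_self hN
      rcases mul_eq_zero.mp this with h | h
      · exact .inl (sub_eq_zero.mp h)
      · exact .inr (sub_eq_zero.mp h)
    have hf (a b : ℤ) : (f (a + b * ω) : ℂ) = a + b * f ω := by simp
    have hmem (α : ℂ) : α ∈ multiplierRing L ↔ ∃ a b : ℤ, a + b * (f ω : ℂ) = α := by
      constructor
      · intro hα
        obtain ⟨⟨x, hx⟩, hx'⟩ := f.surjective ⟨α, hα⟩
        obtain ⟨a, b, rfl⟩ := (mem_quadraticOrder hN).mp hx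
        refine ⟨a, b, ?_⟩
        rw [← hf, show (a + b * ω : quadraticOrder D) = ⟨a + b * orderGen D, hx⟩ from
          Subtype.ext (by simp [ω]), hx']
      · rintro ⟨a, b, rfl⟩
        rw [← hf]
        exact (f (a + b * ω)).2
    intro α
    rw [hmem, mem_quadraticOrder hN]
    rcases hfω' with h | h
    · rw [h]
    · rw [h]
      constructor
      · rintro ⟨a, b, rfl⟩
        exact ⟨a + b * D, -b, by push_cast; ring⟩
      · rintro ⟨a, b, rfl⟩
        exact ⟨a + b * D, -b, by push_cast; ring⟩
  · intro h
    let e : quadraticOrder D ≃+* multiplierRing L :=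
      { toFun := fun x ↦ ⟨x, (h x).mpr x.2⟩
        invFun := fun x ↦ ⟨x, (h x).mp x.2⟩
        left_inv := fun _ ↦ rfl
        right_inv := fun _ ↦ rfl
        map_mul' := fun _ _ ↦ rfl
        map_add' := fun _ _ ↦ rfl }
    exact ⟨e.trans (multiplierRingEquiv L)⟩

/-- The singular moduli of discriminant `-D` are the `j`-invariants of the lattices with ring of
multipliers `ℤ[(D + √-D) / 2]`. -/
lemma mem_cmJInvariants_iff {D : ℕ} {N : ℤ} (hN : 4 * N = D * (D + 1)) (j : ℂ) :
    j ∈ cmJInvariants D ↔ ∃ L : PeriodPair,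
      (∀ α, α ∈ multiplierRing L ↔ α ∈ quadraticOrder D) ∧ latticeJ L = j := by
  constructor
  · rintro ⟨W, hW, ⟨L, ⟨C, hC⟩, hL⟩, rfl⟩
    refine ⟨L, (nonempty_quadraticOrder_equiv_iff hN L).mp hL, ?_⟩
    have := latticeCurve_isElliptic L
    rw [← latticeCurve_j, ← WeierstrassCurve.variableChange_j W C]
    simp only [hC]
  · rintro ⟨L, hL, rfl⟩
    have := latticeCurve_isElliptic L
    exact ⟨latticeCurve L, this, ⟨L, ⟨1, one_smul _ _⟩,
      (nonempty_quadraticOrder_equiv_iff hN L).mpr hL⟩, latticeCurve_j L⟩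

/-! ### Lattices with complex multiplication and real singular moduli -/

lemma exists_min_norm (L : PeriodPair) (p : ℂ → Prop) (h : ∃ x ∈ L.lattice, x ≠ 0 ∧ p x) :
    ∃ v ∈ L.lattice, v ≠ 0 ∧ p v ∧ ∀ x ∈ L.lattice, x ≠ 0 → p x → ‖v‖ ≤ ‖x‖ := by
  obtain ⟨x₀, hx₀, hne, hp⟩ := h
  have hfin : (Metric.closedBall (0 : ℂ) ‖x₀‖ ∩ {x | x ∈ L.lattice ∧ x ≠ 0 ∧ p x}).Finite := by
    have hdisc : IsDiscrete (L.lattice : Set ℂ) := ⟨inferInstanceAs (DiscreteTopology L.lattice)⟩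
    exact Metric.finite_isBounded_inter_isClosed (hdisc.mono fun x hx ↦ hx.1)
      Metric.isBounded_closedBall (L.isClosed_of_subset_lattice fun x hx ↦ hx.1)
  obtain ⟨v, ⟨hv₁, hv₂⟩, hmin⟩ := Set.exists_min_image _ (fun x : ℂ ↦ ‖x‖) hfin
    ⟨x₀, by simp, hx₀, hne, hp⟩
  refine ⟨v, hv₂.1, hv₂.2.1, hv₂.2.2, fun x hx hxne hpx ↦ ?_⟩
  rcases le_total ‖x‖ ‖x₀‖ with h | h
  · exact hmin x ⟨by simpa using h, hx, hxne, hpx⟩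
  · exact (by simpa using hv₁ : ‖v‖ ≤ ‖x₀‖).trans h

/-- A nonzero vector of minimal norm, among those in a set stable under division by positive
integers, is the first vector of a basis. -/
lemma exists_min_norm_basis (L : PeriodPair) (p : ℂ → Prop)
    (hp : ∀ (x : ℂ) (d : ℕ), p x → p (x / d)) (h : ∃ x ∈ L.lattice, x ≠ 0 ∧ p x) :
    ∃ (v : ℂ) (hv : v ≠ 0) (τ : ℍ), L.lattice = (scalePeriods (tauPeriods τ) v hv).lattice ∧ p v ∧
      ∀ x ∈ L.lattice, x ≠ 0 → p x → ‖v‖ ≤ ‖x‖ := by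
  obtain ⟨v, hvL, hv, hpv, hmin⟩ := exists_min_norm L p h
  obtain ⟨m, n, hmn⟩ := PeriodPair.mem_lattice.mp hvL
  have hcop : IsCoprime m n := by
    rw [Int.isCoprime_iff_gcd_eq_one]
    by_contra hd
    set d := Int.gcd m n with hddef
    have hd0 : d ≠ 0 := by
      intro h0
      obtain ⟨rfl, rfl⟩ := Int.gcd_eq_zero_iff.mp h0
      simp at hmn
      exact hv hmn.symm
    have hdC : (d : ℂ) ≠ 0 := Nat.cast_ne_zero.mpr hd0
    obtain ⟨m', hm'⟩ : (d : ℤ) ∣ m := Int.gcd_dvd_left ..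
    obtain ⟨n', hn'⟩ : (d : ℤ) ∣ n := Int.gcd_dvd_right ..
    have hmem : v / d ∈ L.lattice := by
      refine PeriodPair.mem_lattice.mpr ⟨m', n', ?_⟩
      rw [eq_div_iff hdC, ← hmn, hm', hn']
      push_cast
      ring
    have := hmin _ hmem (div_ne_zero hv hdC) (hp v d hpv)
    rw [norm_div, Complex.norm_natCast, le_div_iff₀ (by positivity)] at this
    have h2 : (2 : ℝ) ≤ d := by exact_mod_cast (by omega : 2 ≤ d)
    nlinarith [norm_pos_iff.mpr hv]
  obtain ⟨hv', τ, hτ⟩ := exists_lattice_eq_scalePeriods_tauPeriods L hcop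
  simp only [hmn] at hτ
  exact ⟨v, hv, τ, hτ, hpv, hmin⟩

lemma multiplierRing_congr {L₁ L₂ : PeriodPair} (h : L₁.lattice = L₂.lattice) :
    multiplierRing L₁ = multiplierRing L₂ := by
  ext α
  rw [mem_multiplierRing, mem_multiplierRing, h]

lemma multiplierRing_scalePeriods (L : PeriodPair) {c : ℂ} (hc : c ≠ 0) :
    multiplierRing (scalePeriods L c hc) = multiplierRing L := by
  ext α
  simp only [mem_multiplierRing, mem_scalePeriods_iff]
  constructor
  · intro h x hx
    simpa [mul_div_assoc, hc] using h (c * x) (by simpa [hc] using hx)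
  · intro h x hx
    simpa [mul_div_assoc] using h _ hx

lemma mem_multiplierRing_conjPeriods (L : PeriodPair) (α : ℂ) :
    α ∈ multiplierRing (conjPeriods L) ↔ conj α ∈ multiplierRing L := by
  simp only [mem_multiplierRing, mem_conjPeriods_iff]
  constructor
  · intro h x hx
    simpa using h (conj x) (by simpa using hx)
  · intro h x hx
    simpa using h _ hx

/-- A unimodular change of basis shows that the lattices `ℤ τ + ℤ` and `ℤ τ' + ℤ` are
homothetic. -/
lemma modularJ_eq_of_unimodular {τ τ' : ℍ} {c : ℂ} (hc : c ≠ 0) {m n k l d : ℤ}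
    (hd : m * l - n * k = d) (hdd : d * d = 1) (h₁ : c = m * τ' + n) (h₂ : c * τ = k * τ' + l) :
    modularJ τ = modularJ τ' := by
  rw [← latticeJ_tauPeriods, ← latticeJ_tauPeriods, ← latticeJ_scalePeriods (tauPeriods τ) hc]
  refine latticeJ_congr (Submodule.ext fun x ↦ ?_)
  rw [mem_scalePeriods_tauPeriods, mem_tauPeriods]
  have hdC : (m : ℂ) * l - n * k = d := by exact_mod_cast hd
  have hddC : (d : ℂ) * d = 1 := by exact_mod_cast hdd
  constructor
  · rintro ⟨s, t, rfl⟩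
    refine ⟨s * k + t * m, s * l + t * n, ?_⟩
    push_cast
    linear_combination -s * h₂ - t * h₁
  · rintro ⟨s, t, rfl⟩
    refine ⟨d * (t * m - s * n), d * (s * l - t * k), ?_⟩
    push_cast
    linear_combination d * (t * m - s * n) * h₂ + d * (s * l - t * k) * h₁ +
      d * (s * τ' + t) * hdC + (s * τ' + t) * hddC

lemma modularJ_eq_of_eq_add_int {τ τ' : ℍ} {k : ℤ} (h : (τ : ℂ) = τ' + k) :
    modularJ τ = modularJ τ' :=
  modularJ_eq_of_unimodular (c := 1) one_ne_zero (m := 0) (n := 1) (k := 1) (l := k) (d := -1)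
    (by ring) (by norm_num) (by simp) (by simp [h])

/-- If `ℤ τ + ℤ` is stable under `ω = (D + √-D) / 2`, then `ω = a τ + n` with `a > 0`, and the
imaginary parts compare. -/
lemma exists_orderGen_eq {D : ℕ} (hD : 0 < D) {τ : ℍ}
    (h : orderGen D ∈ multiplierRing (tauPeriods τ)) :
    ∃ a n : ℤ, 0 < a ∧ a * (τ : ℂ) + n = orderGen D ∧ √(D : ℝ) = 2 * a * τ.im := by
  have h1 : (1 : ℂ) ∈ (tauPeriods τ).lattice := (mem_tauPeriods τ 1).mpr ⟨0, 1, by simp⟩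
  obtain ⟨a, n, han⟩ := (mem_tauPeriods τ _).mp (mem_multiplierRing.mp h 1 h1)
  rw [mul_one] at han
  have him := congrArg Complex.im han
  simp at him
  have hs : 0 < √(D : ℝ) := Real.sqrt_pos.mpr (by exact_mod_cast hD)
  have ha : (0 : ℝ) < a := pos_of_mul_pos_left (by rw [him]; positivity) τ.im_pos.le
  exact ⟨a, n, by exact_mod_cast ha, han, by linarith⟩

lemma eq_zero_of_mul_orderGen_add_eq_zero {D : ℕ} (hD : 0 < D) {s t : ℤ}
    (h : s * orderGen D + t = 0) : s = 0 := by
  have hD' : √(D : ℝ) ≠ 0 := (Real.sqrt_pos.mpr (by exact_mod_cast hD)).ne'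
  have := congrArg Complex.im h
  simpa [hD'] using this

lemma finite_cmJInvariants {D : ℕ} (hD : 0 < D) {N : ℤ} (hN : 4 * N = D * (D + 1)) :
    (cmJInvariants D).Finite := by
  have hT : (Set.image2 (fun a r : ℤ ↦ (orderGen D - r) / a) (Set.Icc 1 D) (Set.Ico 0 D)).Finite :=
    (Set.finite_Icc _ _).image2 _ (Set.finite_Ico _ _)
  have hT' := hT.preimage (f := ((↑) : ℍ → ℂ)) UpperHalfPlane.coe_injective.injOn
  refine (hT'.image modularJ).subset fun j hj ↦ ?_
  obtain ⟨L, hL, rfl⟩ := (mem_cmJInvariants_iff hN j).mp hj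
  obtain ⟨v, hv, τ, hLτ, -, hmin⟩ := exists_min_norm_basis L (fun _ ↦ True) (fun _ _ _ ↦ trivial)
    ⟨_, L.ω₁_mem_lattice, fun h ↦ L.ω₁_div_two_notMem_lattice (by simp [h]), trivial⟩
  have hω : orderGen D ∈ multiplierRing (tauPeriods τ) := by
    rw [← multiplierRing_scalePeriods _ hv, ← multiplierRing_congr hLτ, hL]
    exact orderGen_mem D
  obtain ⟨a, n, ha, han, him⟩ := exists_orderGen_eq hD hω
  have haC : (a : ℂ) ≠ 0 := Int.cast_ne_zero.mpr ha.ne'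
  have hj : latticeJ L = modularJ τ := by
    rw [latticeJ_congr hLτ, latticeJ_scalePeriods, latticeJ_tauPeriods]
  -- minimality of the norm of `v` puts `τ`, up to translation, in the fundamental domain
  have him34 : 3 / 4 ≤ τ.im ^ 2 := by
    have hne : (τ : ℂ) - round τ.re ≠ 0 := fun h ↦
      τ.im_ne_zero (by simpa using congrArg Complex.im h)
    have h1 := hmin (v * (τ - round τ.re)) (by
      rw [hLτ, mem_scalePeriods_tauPeriods]
      exact ⟨1, -round τ.re, by push_cast; ring⟩) (mul_ne_zero hv hne) trivial
    rw [norm_mul, le_mul_iff_one_le_right (norm_pos_iff.mpr hv)] at h1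
    have h2 : 1 ≤ ‖(τ : ℂ) - round τ.re‖ ^ 2 := one_le_pow₀ h1
    rw [Complex.sq_norm, Complex.normSq_apply] at h2
    have h3 := abs_le.mp (abs_sub_round τ.re)
    simp at h2
    nlinarith
  have haD : a ≤ D := by
    have h1 : (D : ℝ) = (2 * a * τ.im) ^ 2 := by
      rw [← him, Real.sq_sqrt (Nat.cast_nonneg D)]
    have h2 : (a : ℝ) ^ 2 ≤ D := by nlinarith [sq_nonneg (a : ℝ)]
    have h3 : a ^ 2 ≤ (D : ℤ) := by exact_mod_cast h2
    nlinarith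
  have hmod : (n : ℂ) = a * (n / a : ℤ) + (n % a : ℤ) := by
    exact_mod_cast (Int.mul_ediv_add_emod n a).symm
  let τ' : ℍ := ⟨τ + (n / a : ℤ), by simpa using τ.im_pos⟩
  have hτ' : (τ' : ℂ) = τ + (n / a : ℤ) := rfl
  refine ⟨τ', ⟨a, ⟨ha, haD⟩, n % a, ⟨Int.emod_nonneg _ ha.ne',
    (Int.emod_lt_of_pos _ ha).trans_le haD⟩, ?_⟩, ?_⟩
  · simp only [hτ', ← han]
    rw [div_eq_iff haC]
    linear_combination hmod
  · rw [hj, modularJ_eq_of_eq_add_int hτ']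

lemma conj_mem_quadraticOrder_iff {D : ℕ} {N : ℤ} (hN : 4 * N = D * (D + 1)) (α : ℂ) :
    conj α ∈ quadraticOrder D ↔ α ∈ quadraticOrder D := by
  have key : ∀ α ∈ quadraticOrder D, conj α ∈ quadraticOrder D := by
    intro α hα
    obtain ⟨a, b, rfl⟩ := (mem_quadraticOrder hN).mp hα
    refine (mem_quadraticOrder hN).mpr ⟨a + b * D, -b, ?_⟩
    simp only [map_add, map_mul, conj_orderGen, map_intCast]
    push_cast
    ring
  exact ⟨fun h ↦ by simpa using key _ h, key α⟩

lemma conj_mem_cmJInvariants {D : ℕ} {N : ℤ} (hN : 4 * N = D * (D + 1)) {j : ℂ}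
    (hj : j ∈ cmJInvariants D) : conj j ∈ cmJInvariants D := by
  rw [mem_cmJInvariants_iff hN] at hj ⊢
  obtain ⟨L, hL, rfl⟩ := hj
  refine ⟨conjPeriods L, fun α ↦ ?_, latticeJ_conjPeriods L⟩
  rw [mem_multiplierRing_conjPeriods, hL, conj_mem_quadraticOrder_iff hN]

/-- A lattice with real `j`-invariant is homothetic to one that is stable under complex
conjugation. -/
lemma exists_conj_stable_of_latticeJ_real {L : PeriodPair} (h : conj (latticeJ L) = latticeJ L) :
    ∃ (μ : ℂ) (hμ : μ ≠ 0), ∀ x ∈ (scalePeriods L μ hμ).lattice,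
      conj x ∈ (scalePeriods L μ hμ).lattice := by
  have := latticeCurve_isElliptic L
  have := latticeCurve_isElliptic (conjPeriods L)
  obtain ⟨c, hc, hLc⟩ := exists_lattice_eq_scalePeriods (L₁ := L) (L₂ := conjPeriods L)
    (by rw [latticeJ_conjPeriods, h])
  have hmem (x : ℂ) : conj x ∈ L.lattice ↔ x / c ∈ L.lattice := by
    rw [← mem_conjPeriods_iff, hLc, mem_scalePeriods_iff]
  -- comparing the shortest vectors of `Λ` and of its conjugate `c Λ` shows that `‖c‖ = 1`
  have hnorm : ‖c‖ = 1 := by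
    obtain ⟨v, hvL, hv, -, hmin⟩ := exists_min_norm L (fun _ ↦ True)
      ⟨_, L.ω₁_mem_lattice, fun h ↦ L.ω₁_div_two_notMem_lattice (by simp [h]), trivial⟩
    have hc0 := norm_pos_iff.mpr hc
    have hv0 := norm_pos_iff.mpr hv
    have h₁ := hmin (conj v / c) ((hmem _).mp (by simpa using hvL))
      (div_ne_zero (by simpa using hv) hc) trivial
    have h₂ := hmin (conj (c * v)) ((hmem _).mpr (by simpa [hc] using hvL))
      (by simpa using ⟨hc, hv⟩) trivial
    rw [norm_div, RCLike.norm_conj, le_div_iff₀ hc0] at h₁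
    rw [RCLike.norm_conj, norm_mul] at h₂
    exact le_antisymm (by nlinarith) (by nlinarith)
  -- for `μ² = c` with `‖μ‖ = 1`, the conjugate of `μ Λ` is `μ⁻¹ c Λ = μ Λ`
  obtain ⟨μ, hμc⟩ := IsAlgClosed.exists_pow_nat_eq c two_pos
  have hμ : μ ≠ 0 := by
    rintro rfl
    exact hc (by simpa using hμc.symm)
  have hμnorm : conj μ * μ = 1 := by
    have : ‖μ‖ = 1 := by
      rw [← pow_eq_one_iff_of_nonneg (norm_nonneg μ) two_ne_zero, ← norm_pow, hμc, hnorm]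
    rw [mul_comm, mul_conj, normSq_eq_norm_sq, this]
    simp
  refine ⟨μ, hμ, fun x hx ↦ ?_⟩
  rw [mem_scalePeriods_iff] at hx ⊢
  have h₁ := (hmem (conj (x / μ))).mp (by simpa using hx)
  convert h₁ using 1
  have hμ' : conj μ ≠ 0 := by simpa using hμ
  rw [map_div₀, ← hμc]
  field_simp
  linear_combination conj x * hμnorm

/-- The possible real lattices: if `4 a c = a² p² + D` and `a`, `c` are not both even, then
`a = 1` or `a = ℓ`, and the parity of `p` is determined by `D`. -/
lemma eq_one_or_eq_prime_of_four_mul_mul_eq {ℓ : ℕ} (hℓ : ℓ.Prime) (hmod : ℓ % 4 = 3)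
    {D : ℕ} (hD : D = ℓ ∨ D = 4 * ℓ) {a c p : ℤ} (ha : 0 < a)
    (h : 4 * (a * c) = a ^ 2 * p ^ 2 + D) (hac : ¬ (2 ∣ a ∧ 2 ∣ c)) :
    (a = 1 ∨ a = ℓ) ∧ ((D = ℓ ∧ Odd p) ∨ (D = 4 * ℓ ∧ Even p)) := by
  have hdvd (b : ℤ) (hb : 0 < b) (h : b ∣ ℓ) : b = 1 ∨ b = ℓ := by
    lift b to ℕ using hb.le
    have := (Nat.dvd_prime hℓ).mp (Int.natCast_dvd_natCast.mp h)
    exact_mod_cast this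
  have hℓ4 : (ℓ : ℤ) % 4 = 3 := by omega
  rcases hD with rfl | rfl
  · refine ⟨hdvd a ha ⟨4 * c - a * p ^ 2, by linear_combination -h⟩, .inl ⟨rfl, ?_⟩⟩
    by_contra hp
    obtain ⟨k, rfl⟩ := Int.not_odd_iff_even.mp hp
    have : (D : ℤ) = 2 * (2 * (a * c) - 2 * (a ^ 2 * k ^ 2)) := by linear_combination -h
    omega
  · push_cast at h
    rcases Int.even_or_odd p with hp | hp
    · refine ⟨?_, .inr ⟨rfl, hp⟩⟩
      obtain ⟨k, rfl⟩ := hp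
      exact hdvd a ha ⟨c - a * k ^ 2, by linarith⟩
    · exfalso
      obtain ⟨r, hr⟩ : ∃ r, p ^ 2 = 4 * r + 1 := by
        obtain ⟨k, rfl⟩ := hp
        exact ⟨k ^ 2 + k, by ring⟩
      have ha2 : Even a := by
        by_contra hodd
        obtain ⟨k, rfl⟩ := Int.not_even_iff_odd.mp hodd
        have : (1 : ℤ) = 4 * ((2 * k + 1) * c - ℓ - (k ^ 2 + k) * p ^ 2 - r) := by
          linear_combination -h - hr
        omega
      obtain ⟨b, rfl⟩ := ha2
      have hb : (ℓ : ℤ) = b * (2 * c - b * p ^ 2) := by linarith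
      have hc : Even c := by
        rcases hdvd b (by omega) ⟨_, hb⟩ with rfl | rfl
        · have : 2 * c = ℓ + 4 * r + 1 := by linear_combination -hb + hr
          exact ⟨c / 2, by omega⟩
        · have hℓ0 : (ℓ : ℤ) ≠ 0 := by exact_mod_cast hℓ.ne_zero
          have : 1 = 2 * c - ℓ * p ^ 2 := mul_left_cancel₀ hℓ0 (by linear_combination hb)
          have : 2 * c = 4 * (ℓ * r) + ℓ + 1 := by linear_combination -this + ℓ * hr
          exact ⟨c / 2, by omega⟩
      exact hac ⟨⟨b, by ring⟩, hc.two_dvd⟩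

/-- The point `(D + √-D) / 2` of the upper half-plane. -/
def orderPoint (D : ℕ) (hD : 0 < D) : ℍ :=
  ⟨orderGen D, by simpa using hD⟩

lemma coe_orderPoint (D : ℕ) (hD : 0 < D) : (orderPoint D hD : ℂ) = orderGen D := rfl

/-- The order is a lattice that is its own ring of multipliers. -/
lemma modularJ_orderPoint_mem {D : ℕ} (hD : 0 < D) {N : ℤ} (hN : 4 * N = D * (D + 1)) :
    modularJ (orderPoint D hD) ∈ cmJInvariants D := by
  refine (mem_cmJInvariants_iff hN _).mpr ⟨_, fun α ↦ ?_, latticeJ_tauPeriods _⟩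
  have hmem (x : ℂ) : x ∈ (tauPeriods (orderPoint D hD)).lattice ↔ x ∈ quadraticOrder D := by
    rw [mem_tauPeriods, mem_quadraticOrder hN, coe_orderPoint]
    exact ⟨fun ⟨m, n, h⟩ ↦ ⟨n, m, by rw [← h]; ring⟩, fun ⟨m, n, h⟩ ↦ ⟨n, m, by rw [← h]; ring⟩⟩
  simp only [mem_multiplierRing, hmem]
  exact ⟨fun h ↦ by simpa using h 1 (one_mem _), fun h x hx ↦ mul_mem h hx⟩

/-- If `ℤ τ + ℤ` is stable under conjugation and has the ring of multipliers `ℤ[(D + √-D) / 2]`,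
then `p = 2 Re τ` is an integer and `a τ² - a p τ + c = 0` with integers `a > 0` and `c` not both even;
the discriminant of this equation is `-D`. -/
lemma exists_form_of_conj_stable {D : ℕ} (hD : 0 < D) {N : ℤ} (hN : 4 * N = D * (D + 1)) {τ : ℍ}
    (hM : ∀ α, α ∈ multiplierRing (tauPeriods τ) ↔ α ∈ quadraticOrder D)
    (hconj : conj (τ : ℂ) ∈ (tauPeriods τ).lattice) :
    ∃ a c p n : ℤ, 0 < a ∧ 4 * (a * c) = a ^ 2 * p ^ 2 + D ∧ ¬ (2 ∣ a ∧ 2 ∣ c) ∧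
      a * (τ : ℂ) + n = orderGen D ∧ D - 2 * n = a * p := by
  have hωM := (hM _).mpr (orderGen_mem D)
  obtain ⟨a, n, ha, han, him⟩ := exists_orderGen_eq hD hωM
  have hτ : (τ : ℂ) ∈ (tauPeriods τ).lattice := (mem_tauPeriods τ _).mpr ⟨1, 0, by simp⟩
  obtain ⟨k, p, hkp⟩ := (mem_tauPeriods τ _).mp hconj
  have hre : 2 * τ.re = p := by
    have h₁ := congrArg Complex.im hkp
    have h₂ := congrArg Complex.re hkp
    simp at h₁ h₂
    have : (k : ℝ) = -1 := mul_right_cancel₀ τ.im_ne_zero (by linarith)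
    rw [this] at h₂
    linarith
  have hp : (D : ℤ) - 2 * n = a * p := by
    have h₁ := congrArg Complex.re han
    simp at h₁
    have : (D : ℝ) - 2 * n = a * p := by rw [← hre]; linarith
    exact_mod_cast this
  obtain ⟨y, x, hyx⟩ := (mem_tauPeriods τ _).mp (mem_multiplierRing.mp hωM τ hτ)
  -- comparison of the two expressions for `ω (ω - n) = a ω τ` in the basis `1, ω`
  have hmain : ((y - (D - n) : ℤ) : ℂ) * orderGen D + ((a * x - y * n + N : ℤ) : ℂ) = 0 := by
    push_cast
    linear_combination a * hyx - y * han + orderGen D * han + orderGen_mul_self hN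
  have hy : y = D - n := sub_eq_zero.mp (eq_zero_of_mul_orderGen_add_eq_zero hD hmain)
  have hx : a * x - y * n + N = 0 := by
    rw [hy, sub_self, Int.cast_zero, zero_mul, zero_add] at hmain
    rw [hy]
    exact_mod_cast hmain
  refine ⟨a, -x, p, n, ha, ?_, ?_, han, hp⟩
  · rw [hy] at hx
    linear_combination -4 * hx + hN + (D - 2 * n + a * p) * hp
  · -- a common factor `2` would make `(a / 2) τ` a multiplier outside the order
    rintro ⟨⟨a', rfl⟩, hx2⟩
    obtain ⟨x', rfl⟩ := (dvd_neg.mp hx2)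
    have hyC : (y : ℂ) - n = 2 * a' * p := by
      have : y - n = 2 * a' * p := by linarith
      exact_mod_cast this
    push_cast at han hyx
    have hsq : (a' * (τ : ℂ)) * (τ : ℂ) = a' * p * τ + x' := by
      linear_combination (τ : ℂ) / 2 * han - hyx / 2 + τ / 2 * hyC
    have hmem : a' * (τ : ℂ) ∈ multiplierRing (tauPeriods τ) := by
      intro z hz
      obtain ⟨m, l, rfl⟩ := (mem_tauPeriods τ z).mp hz
      refine (mem_tauPeriods τ _).mpr ⟨m * a' * p + l * a', m * x', ?_⟩
      push_cast
      linear_combination -(m : ℂ) * hsq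
    obtain ⟨s, t, hst⟩ := (mem_quadraticOrder hN).mp ((hM _).mp hmem)
    have h₁ : ((2 * t - 1 : ℤ) : ℂ) * orderGen D + ((2 * s + n : ℤ) : ℂ) = 0 := by
      push_cast
      linear_combination 2 * hst + han
    have h₂ := eq_zero_of_mul_orderGen_add_eq_zero hD h₁
    omega

/-- A real singular modulus of discriminant `-ℓ` or `-4ℓ` is the one of the order itself. -/
theorem eq_modularJ_orderPoint_of_real {ℓ : ℕ} (hℓ : ℓ.Prime) (hmod : ℓ % 4 = 3) {D : ℕ}
    (hDℓ : D = ℓ ∨ D = 4 * ℓ) (hD : 0 < D) {N : ℤ} (hN : 4 * N = D * (D + 1)) {j : ℂ}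
    (hj : j ∈ cmJInvariants D) (hreal : conj j = j) : j = modularJ (orderPoint D hD) := by
  obtain ⟨L, hL, rfl⟩ := (mem_cmJInvariants_iff hN j).mp hj
  obtain ⟨μ, hμ, hstable⟩ := exists_conj_stable_of_latticeJ_real hreal
  set L' := scalePeriods L μ hμ
  -- a shortest real vector `v` is the first vector of a basis
  obtain ⟨v, hv, τ, hLτ, hvim, -⟩ := exists_min_norm_basis L' (fun x ↦ x.im = 0)
    (fun x d hx ↦ by simp [hx]) (by
      by_contra! hno
      have h (x : ℂ) (hx : x ∈ L'.lattice) : x.re = 0 := by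
        by_contra hre
        refine hno (x + conj x) (add_mem hx (hstable x hx)) (fun h0 ↦ hre ?_) (by simp)
        have := congrArg Complex.re h0
        simp at this
        linarith
      have h₁ := h _ L'.ω₁_mem_lattice
      have h₂ := h _ L'.ω₂_mem_lattice
      obtain ⟨h₃, h₄⟩ := LinearIndependent.pair_iff.mp L'.indep L'.ω₂.im (-L'.ω₁.im) (by
        apply Complex.ext <;> simp [h₁, h₂]
        ring)
      exact L'.ω₁_div_two_notMem_lattice (by
        rw [show L'.ω₁ = 0 from Complex.ext h₁ (by simpa using h₄)]
        simp))
  have hM : ∀ α, α ∈ multiplierRing (tauPeriods τ) ↔ α ∈ quadraticOrder D := by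
    intro α
    rw [← hL, ← multiplierRing_scalePeriods (tauPeriods τ) hv, ← multiplierRing_congr hLτ,
      multiplierRing_scalePeriods]
  have hconj : conj (τ : ℂ) ∈ (tauPeriods τ).lattice := by
    have hvτ : v * τ ∈ L'.lattice := by
      rw [hLτ, mul_mem_scalePeriods_iff]
      exact (mem_tauPeriods τ _).mpr ⟨1, 0, by simp⟩
    have := hstable _ hvτ
    rwa [map_mul, conj_eq_iff_im.mpr hvim, hLτ, mul_mem_scalePeriods_iff] at this
  rw [← latticeJ_scalePeriods L hμ, latticeJ_congr hLτ, latticeJ_scalePeriods, latticeJ_tauPeriods]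
  obtain ⟨a, c, p, n, ha, hac, hprim, han, hp⟩ := exists_form_of_conj_stable hD hN hM hconj
  obtain ⟨haℓ, hpar⟩ := eq_one_or_eq_prime_of_four_mul_mul_eq hℓ hmod hDℓ ha hac hprim
  have hℓ0 : ℓ ≠ 0 := hℓ.ne_zero
  have hω2 := orderGen_mul_self hN
  rcases haℓ with rfl | rfl
  · refine (modularJ_eq_of_eq_add_int (k := n) ?_).symm
    rw [coe_orderPoint, ← han]
    simp
  have hℓC : (ℓ : ℂ) ≠ 0 := Nat.cast_ne_zero.mpr hℓ0
  have hNC : (4 : ℂ) * N = D * (D + 1) := by exact_mod_cast hN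
  have hpC : (D : ℂ) - 2 * n = ℓ * p := by exact_mod_cast hp
  push_cast at han
  rcases hpar with ⟨rfl, k, rfl⟩ | ⟨rfl, k, rfl⟩
  -- multiplication by `√-ℓ` identifies the lattice with the order
  · obtain ⟨e, he⟩ : Odd D := Nat.odd_iff.mpr (by omega)
    have heC : (D : ℂ) = 2 * e + 1 := by exact_mod_cast he
    have heZ : (D : ℤ) = 2 * e + 1 := by exact_mod_cast he
    refine modularJ_eq_of_unimodular (c := 2 * orderGen D - D) (m := 2) (n := -D) (k := 2 * k + 1)
      (l := -(e + 1) - k * D) (d := -1) (fun h ↦ ?_) (by linear_combination heZ) (by norm_num)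
      (by rw [coe_orderPoint]; push_cast; ring) (mul_left_cancel₀ hℓC ?_)
    · have := eq_zero_of_mul_orderGen_add_eq_zero hD (s := 2) (t := -D)
        (by push_cast; linear_combination h)
      omega
    · rw [coe_orderPoint]
      push_cast at hpC ⊢
      linear_combination (2 * orderGen D - D) * han + 2 * hω2 + (2 * orderGen D - D) / 2 * hpC -
        hNC / 2 - D / 2 * heC
  · refine modularJ_eq_of_unimodular (c := orderGen (4 * ℓ) - 2 * ℓ) (m := 1) (n := -(2 * ℓ))
      (k := k) (l := -1 - 2 * k * ℓ) (d := -1) (fun h ↦ ?_) (by ring) (by norm_num)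
      (by rw [coe_orderPoint]; push_cast; ring) (mul_left_cancel₀ hℓC ?_)
    · have := eq_zero_of_mul_orderGen_add_eq_zero hD (s := 1) (t := -(2 * ℓ))
        (by push_cast; linear_combination h)
      omega
    · rw [coe_orderPoint]
      push_cast at hpC hNC hω2 ⊢
      linear_combination (orderGen (4 * ℓ) - 2 * ℓ) * han + hω2 +
        (orderGen (4 * ℓ) - 2 * ℓ) / 2 * hpC - hNC / 4

/-! ### The sign of the polynomial `P_D` -/

/-- For a finite set of complex numbers that is stable under conjugation and contains `r` as its
only real element, the non-real elements contribute a positive factor to `∏ (y - j)`. -/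
lemma exists_prod_sub_eq_of_conj_stable {S : Finset ℂ} (hS : ∀ j ∈ S, conj j ∈ S) {r : ℝ}
    (hr : (r : ℂ) ∈ S) (huniq : ∀ j ∈ S, conj j = j → j = r) (y : ℝ) :
    ∃ R : ℝ, 0 < R ∧ ∏ j ∈ S, ((y : ℂ) - j) = (((y - r) * R : ℝ) : ℂ) := by
  classical
  have him (j : ℂ) (hj : j ∈ S.erase r) : j.im ≠ 0 := fun h ↦
    (Finset.mem_erase.mp hj).1 (huniq j (Finset.mem_of_mem_erase hj) (conj_eq_iff_im.mpr h))
  have hneg : ∏ j ∈ S.erase ↑r with ¬ 0 < j.im, ((y : ℂ) - j) =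
      ∏ j ∈ S.erase ↑r with 0 < j.im, ((y : ℂ) - conj j) := by
    refine Finset.prod_nbij' (fun j ↦ conj j) (fun j ↦ conj j) ?_ ?_ (by simp) (by simp) (by simp)
    · intro j hj
      obtain ⟨h₁, h₂⟩ := Finset.mem_filter.mp hj
      refine Finset.mem_filter.mpr ⟨Finset.mem_erase.mpr ⟨fun h ↦ him j h₁ ?_,
        hS j (Finset.mem_of_mem_erase h₁)⟩, ?_⟩
      · simpa using congrArg Complex.im h
      · rw [conj_im, neg_pos]
        exact lt_of_le_of_ne (not_lt.mp h₂) (him j h₁)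
    · intro j hj
      obtain ⟨h₁, h₂⟩ := Finset.mem_filter.mp hj
      refine Finset.mem_filter.mpr ⟨Finset.mem_erase.mpr ⟨fun h ↦ him j h₁ ?_,
        hS j (Finset.mem_of_mem_erase h₁)⟩, ?_⟩
      · simpa using congrArg Complex.im h
      · rw [conj_im, neg_pos]
        exact h₂.not_gt
  refine ⟨∏ j ∈ S.erase ↑r with 0 < j.im, normSq ((y : ℂ) - j), Finset.prod_pos fun j hj ↦ ?_, ?_⟩
  · refine normSq_pos.mpr fun h ↦ him j (Finset.mem_filter.mp hj).1 ?_
    simpa using congrArg Complex.im h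
  · rw [← Finset.mul_prod_erase S _ hr, ← Finset.prod_filter_mul_prod_filter_not (S.erase ↑r)
      (fun j ↦ 0 < j.im), hneg, ← Finset.prod_mul_distrib]
    push_cast
    congr 1
    refine Finset.prod_congr rfl fun j _ ↦ ?_
    rw [← mul_conj]
    simp

/-- The polynomial `P_D` is `X - r`, for its only real root `r`, times a factor that is positive on
the real line. -/
lemma exists_eval_cmPolynomial_eq {ℓ : ℕ} (hℓ : ℓ.Prime) (hmod : ℓ % 4 = 3) {D : ℕ}
    (hDℓ : D = ℓ ∨ D = 4 * ℓ) (hD : 0 < D) {r : ℝ} (hr : modularJ (orderPoint D hD) = r) (y : ℝ) :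
    (cmJInvariants D).Finite ∧
      ∃ R : ℝ, 0 < R ∧ (cmPolynomial D).eval (y : ℂ) = (((y - r) * R : ℝ) : ℂ) := by
  obtain ⟨N, hN⟩ : ∃ N : ℤ, 4 * N = D * (D + 1) := by
    rcases hDℓ with rfl | rfl
    · obtain ⟨e, he⟩ : ∃ e : ℤ, (D : ℤ) = 4 * e + 3 := ⟨D / 4, by omega⟩
      exact ⟨D * (e + 1), by rw [he]; ring⟩
    · exact ⟨ℓ * (4 * ℓ + 1), by push_cast; ring⟩
  have hfin := finite_cmJInvariants hD hN
  refine ⟨hfin, ?_⟩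
  obtain ⟨R, hR, h⟩ := exists_prod_sub_eq_of_conj_stable (S := hfin.toFinset) (r := r)
    (fun j hj ↦ by
      rw [Set.Finite.mem_toFinset] at hj ⊢
      exact conj_mem_cmJInvariants hN hj)
    (by rw [Set.Finite.mem_toFinset, ← hr]; exact modularJ_orderPoint_mem hD hN)
    (fun j hj hreal ↦ by
      rw [Set.Finite.mem_toFinset] at hj
      rw [← hr]
      exact eq_modularJ_orderPoint_of_real hℓ hmod hDℓ hD hN hj hreal) y
  refine ⟨R, hR, ?_⟩
  rw [← h, cmPolynomial, finprod_mem_eq_finite_toFinset_prod _ hfin, Polynomial.eval_prod]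
  simp

lemma modularJ_orderPoint_prime {ℓ : ℕ} (hℓ : 0 < ℓ) (hodd : ℓ % 2 = 1) :
    modularJ (orderPoint ℓ hℓ) = modularJ (halfOneAddSqrtNeg ℓ hℓ) := by
  obtain ⟨e, he⟩ : Odd ℓ := Nat.odd_iff.mpr hodd
  have heC : (ℓ : ℂ) = 2 * e + 1 := by exact_mod_cast he
  refine modularJ_eq_of_eq_add_int (k := e) ?_
  change orderGen ℓ = (1 + I * (√(ℓ : ℝ) : ℂ)) / 2 + _
  rw [orderGen]
  push_cast
  linear_combination heC / 2

lemma modularJ_orderPoint_four_mul {ℓ : ℕ} (hℓ : 0 < ℓ) (h : 0 < 4 * ℓ) :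
    modularJ (orderPoint (4 * ℓ) h) = modularJ (sqrtNeg ℓ hℓ) := by
  refine modularJ_eq_of_eq_add_int (k := 2 * ℓ) ?_
  change orderGen (4 * ℓ) = I * (√(ℓ : ℝ) : ℂ) + _
  have hs : √((4 * ℓ : ℕ) : ℝ) = 2 * √(ℓ : ℝ) := by
    rw [Nat.cast_mul, Real.sqrt_mul (by norm_num), show ((4 : ℕ) : ℝ) = 2 ^ 2 by norm_num,
      Real.sqrt_sq (by norm_num)]
  rw [orderGen, hs]
  push_cast
  ring

end SingularModuli

end

theorem mainTheorem10 (E : WeierstrassCurve ℚ) [E.IsElliptic] (ℓ : ℕ) (hℓ : ℓ.Prime)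
    (hmod : ℓ % 4 = 3) (hB : max (SingularModuli.jBound (E.j : ℝ)) 7 < (ℓ : ℝ)) :
    (SingularModuli.modularJ (SingularModuli.halfOneAddSqrtNeg ℓ hℓ.pos) < (E.j : ℂ) ∧
      (E.j : ℂ) < SingularModuli.modularJ (SingularModuli.sqrtNeg ℓ hℓ.pos)) ∧
    ((SingularModuli.cmJInvariants ℓ).Finite ∧
      0 < (SingularModuli.cmPolynomial ℓ).eval (E.j : ℂ)) ∧
    ((SingularModuli.cmJInvariants (4 * ℓ)).Finite ∧
      (SingularModuli.cmPolynomial (4 * ℓ)).eval (E.j : ℂ) < 0) := by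
  obtain ⟨hB, h7⟩ := max_lt_iff.mp hB
  have h7' : 7 < ℓ := by exact_mod_cast h7
  obtain ⟨x₁, hx₁, hlt₁⟩ :=
    SingularModuli.exists_modularJ_halfOneAddSqrtNeg hℓ.pos (by omega) hB
  obtain ⟨x₂, hx₂, hlt₂⟩ := SingularModuli.exists_modularJ_sqrtNeg hℓ.pos hB
  have hy : (E.j : ℂ) = ((E.j : ℝ) : ℂ) := by simp
  obtain ⟨hfin₁, R₁, hR₁, he₁⟩ := SingularModuli.exists_eval_cmPolynomial_eq hℓ hmod (.inl rfl)
    hℓ.pos ((SingularModuli.modularJ_orderPoint_prime hℓ.pos (by omega)).trans hx₁) (E.j : ℝ)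
  have h4 : 0 < 4 * ℓ := by have := hℓ.pos; omega
  obtain ⟨hfin₂, R₂, hR₂, he₂⟩ := SingularModuli.exists_eval_cmPolynomial_eq hℓ hmod (.inr rfl)
    h4 ((SingularModuli.modularJ_orderPoint_four_mul hℓ.pos h4).trans hx₂) (E.j : ℝ)
  rw [hy, hx₁, hx₂, he₁, he₂]
  refine ⟨⟨?_, ?_⟩, ⟨hfin₁, ?_⟩, hfin₂, ?_⟩
  · exact Complex.real_lt_real.mpr hlt₁
  · exact Complex.real_lt_real.mpr hlt₂
  · exact_mod_cast mul_pos (sub_pos.mpr hlt₁) hR₁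
  · exact_mod_cast mul_neg_of_neg_of_pos (sub_neg.mpr hlt₂) hR₂
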